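/- **Notation.** For a finite graph $H$ and $S\subseteq V(H)$, let $\mathrm{mvc}_S(H)$ be the least size of a vertex cover of $H$ containing $S$. Let $\mathrm{evc}_S(H)$ be the least number of guards that can defend $H$ forever with every vertex of $S$ occupied in all configurations: guards always occupy a vertex cover; when an edge is attacked, all guards move simultaneously, each staying or crossing one edge, and some guard must cross the attacked edge; the attacks are arbitrary and unending, and the defender sees them one at a time. This has two models: at most one guard per vertex, or no such restriction. Subscripts list the elements of $S$ and are omitted if $S=\emptyset$. For an edge $ab$ of $H$ put $\mathscr M(H,ab)=(\mathrm{mvc},\mathrm{mvc}_a,\mathrm{mvc}_b,\mathrm{mvc}_{ab})(H)$ and $\mathscr E(H,ab)=(\mathrm{evc},\mathrm{evc}_a,\mathrm{evc}_b,\mathrm{evc}_{ab})(H)$. **Theorem.** Let $G$ be a maximal outerplanar graph (outerplanar, and not outerplanar after the addition of any edge between existing vertices) with a fixed outerplanar embedding, and let $uv$ be an edge on its outer face with $\deg(u)>2$ and $\deg(v)>2$. Then $u$ and $v$ have a unique common neighbour $w$. Let $G_u$ be the largest biconnected subgraph of $G$ that has $uw$ on its outer face and does not contain $v$, and $G_v$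 the largest biconnected subgraph that has $vw$ on its outer face and does not contain $u$ (both exist). Put $k_u=\mathrm{mvc}(G_u)$, $k_v=\mathrm{mvc}(G_v)$. In both models the following holds. 1. There is one program, independent of $G$, that computes $\mathrm{evc}(G)$ in constant time (a bounded number of steps of a unit-cost register machine) from $\mathscr M(G_u,uw)$, $\mathscr E(G_u,uw)$, $\mathscr M(G_v,vw)$, $\mathscr E(G_v,vw)$. Explicitly, $\mathrm{mvc}(G)=\min\{\mathrm{mvc}_w(G_u)+\mathrm{mvc}_{vw}(G_v)-1,\ \mathrm{mvc}_{uw}(G_u)+\mathrm{mvc}_w(G_v)-1,\ k_u+k_v\}$, and * if $\mathrm{evc}(G_u)=k_u$, $\mathrm{evc}(G_v)=k_v$: $\mathrm{evc}(G)=\max\{\mathrm{evc}_w(G_u)+k_v-1,\ k_u+\mathrm{evc}_w(G_v)-1\}$; * if $\mathrm{evc}(G_u)=k_u$, $\mathrm{evc}(G_v)=k_v+1$: $\mathrm{evc}(G)=\min\{\mathrm{mvc}(G)+1,\ \mathrm{evc}(G_u)+\mathrm{evc}_{vw}(G_v)-1,\ \mathrm{mvc}_{uw}(G_u)+\mathrm{evc}_w(G_v)-1\}$;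 * if $\mathrm{evc}(G_u)=k_u+1$, $\mathrm{evc}(G_v)=k_v+1$: $\mathrm{evc}(G)=\min\{\mathrm{mvc}(G)+1,\ \max\{\mathrm{evc}_{uw}(G_u)+\mathrm{mvc}_w(G_v)-1,\ \mathrm{mvc}_w(G_u)+\mathrm{evc}_{vw}(G_v)-1\}\}$. 2. There is one program, independent of $G$, that computes $\mathrm{evc}_u(G)$, $\mathrm{evc}_v(G)$, $\mathrm{evc}_{uv}(G)$ in constant time from $\mathrm{evc}(G)$, $\mathscr M(G,uv)$, $\mathscr M(G_u,uw)$, $\mathscr E(G_u,uw)$, $\mathscr M(G_v,vw)$, $\mathscr E(G_v,vw)$. Explicitly: * if $\mathrm{evc}(G_u)=k_u$, $\mathrm{evc}(G_v)=k_v$ and $\mathrm{evc}(G)=k_u+k_v-1$: $\mathrm{evc}_u(G)=\mathrm{evc}_{uw}(G_u)+k_v-1$, $\mathrm{evc}_v(G)=\mathrm{evc}_{vw}(G_v)+k_u-1$, $\mathrm{evc}_{uv}(G)=\min\{\mathrm{mvc}_{uv}(G)+1,\ \mathrm{evc}_{uw}(G_u)+\mathrm{evc}_{vw}(G_v)-1\}$;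 * if $\mathrm{evc}(G_u)=k_u$, $\mathrm{evc}(G_v)=k_v$ and $\mathrm{evc}(G)=k_u+k_v$: $\mathrm{evc}_u(G)=\mathrm{evc}_v(G)=\mathrm{evc}(G)$, $\mathrm{evc}_{uv}(G)=\min\{\mathrm{evc}_u(G_u)+k_v,\ \mathrm{evc}_v(G_v)+k_u,\ \mathrm{mvc}_{uv}(G)+1\}$; * if $\mathrm{evc}(G_u)=k_u$, $\mathrm{evc}(G_v)=k_v+1$ and $\mathrm{mvc}(G)=k_u+k_v-1$: $\mathrm{evc}_u(G)=\mathrm{mvc}_{uw}(G_u)+\mathrm{evc}(G_v)-1$, $\mathrm{evc}_v(G)=\min\{\mathrm{mvc}_v(G)+1,\ \mathrm{evc}_w(G_u)+\mathrm{evc}_{vw}(G_v)-1,\ \max\{\mathrm{mvc}_w(G_u)+\mathrm{evc}_{vw}(G_v)-1,\ \mathrm{evc}(G_u)+\mathrm{mvc}_v(G_v)\}\}$, $\mathrm{evc}_{uv}(G)=\min\{\mathrm{mvc}_{uv}(G)+1,\ \mathrm{evc}_{uw}(G_u)+\mathrm{evc}_{vw}(G_v)-1,\ \mathrm{evc}_u(G_u)+\max\{\mathrm{evc}_{vw}(G_v)-1,\mathrm{mvc}_v(G_v)\}\}$;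 * if $\mathrm{evc}(G_u)=k_u$, $\mathrm{evc}(G_v)=k_v+1$ and $\mathrm{mvc}(G)=\mathrm{evc}(G)=k_u+k_v$: $\mathrm{evc}_u(G)=\mathrm{evc}_u(G_u)+\mathrm{evc}_w(G_v)-1$, $\mathrm{evc}_v(G)$ is given by the same formula as in the previous case, $\mathrm{evc}_{uv}(G)=\min\{\mathrm{evc}(G)+1,\ \max\{\mathrm{evc}_u(G_u)+\mathrm{mvc}_v(G_v),\ \mathrm{evc}_u(G_u)+\mathrm{evc}_{vw}(G_v)-1\}\}$; * if $\mathrm{evc}(G_u)=k_u$, $\mathrm{evc}(G_v)=k_v+1$ and $\mathrm{evc}(G)=k_u+k_v+1$: $\mathrm{evc}_u(G)=\mathrm{evc}_v(G)=\mathrm{evc}(G)$, $\mathrm{evc}_{uv}(G)=\min\{\mathrm{mvc}_{uv}(G)+1,\ \mathrm{evc}(G_u)+\mathrm{evc}_v(G_v)\}$; * if $\mathrm{evc}(G_u)=k_u+1$, $\mathrm{evc}(G_v)=k_v+1$: $\mathrm{evc}_u(G)=\min\{\mathrm{mvc}_u(G)+1,\ \mathrm{evc}_u(G_u)+\mathrm{evc}_w(G_v)-1\}$,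 $\mathrm{evc}_v(G)=\min\{\mathrm{mvc}_v(G)+1,\ \mathrm{evc}_v(G_v)+\mathrm{evc}_w(G_u)-1\}$; moreover $\mathrm{evc}_{uv}(G)=\mathrm{mvc}_{uv}(G)+1$ if $\mathrm{mvc}_{uv}(G)\le k_u+k_v$, and otherwise $\mathrm{evc}_{uv}(G)=\min\{\mathrm{mvc}_{uv}(G)+1,\ \max\{P_1,P_2\}\}$ with $P_1=\min\{\mathrm{evc}_{uw}(G_u)+\mathrm{mvc}_{vw}(G_v)-1,\ \mathrm{evc}_u(G_u)+\mathrm{mvc}_v(G_v)\}$ and $P_2=\min\{\mathrm{mvc}_{uw}(G_u)+\mathrm{evc}_{vw}(G_v)-1,\ \mathrm{mvc}_u(G_u)+\mathrm{evc}_v(G_v)\}$. In both parts the case $\mathrm{evc}(G_u)=k_u+1$, $\mathrm{evc}(G_v)=k_v$ is obtained by exchanging $u$ and $v$; the listed cases together with these are exhaustive. -/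

import Mathlib

universe u

namespace EternalCover

/-! ## Vertex covers and the guarding game -/

/-- `mvc G S`: the least size of a vertex cover of `G` that contains every vertex of `S`.
(For finite `G` the set below is nonempty: the set of all vertices qualifies.) -/
noncomputable def mvc {V : Type u} (G : SimpleGraph V) (S : Set V) : ℕ :=
  sInf {k | ∃ C : Finset V, C.card = k ∧ G.IsVertexCover (C : Set V) ∧ S ⊆ (C : Set V)}

/-- The two models of the game: at most one guard on a vertex, or no restriction. -/
inductive GuardModel
  | single
  | multi

/-- `p` places `k` guards, guard `i` standing on the vertex `p i`.  It is an admissible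
configuration if the occupied vertices form a vertex cover and contain `S`, and, in the
one-guard-per-vertex model, no two guards share a vertex. -/
def IsConfig {V : Type u} (m : GuardModel) (G : SimpleGraph V) (S : Set V) {k : ℕ}
    (p : Fin k → V) : Prop :=
  G.IsVertexCover (Set.range p) ∧ S ⊆ Set.range p ∧ (m = GuardModel.single → Function.Injective p)

/-- All guards move simultaneously from `p` to `q`, each staying or crossing one edge, and
some guard crosses the attacked edge `e`. -/
def Defends {V : Type u} (G : SimpleGraph V) {k : ℕ} (e : Sym2 V) (p q : Fin k → V) : Prop :=
  (∀ i, q i = p i ∨ G.Adj (p i) (q i)) ∧ ∃ i, s(p i, q i) = e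

/-- `k` guards can defend `G` forever, with all vertices of `S` occupied in all configurations:
there is a strategy `σ` that assigns a configuration to every finite history of attacked edges
(latest attack first) and reacts to each further attack by a legal defending move. -/
def Defendable {V : Type u} (m : GuardModel) (G : SimpleGraph V) (S : Set V) (k : ℕ) : Prop :=
  ∃ σ : List G.edgeSet → (Fin k → V),
    (∀ h, IsConfig m G S (σ h)) ∧ ∀ h (e : G.edgeSet), Defends G e.1 (σ h) (σ (e :: h))

/-- `evc m G S`: the least number of guards that can defend `G` forever with all vertices of
`S` occupied in all configurations.  (For finite `G` some number works: put a guard on every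
vertex and answer an attack by exchanging the guards at the two ends of the edge.) -/
noncomputable def evc {V : Type u} (m : GuardModel) (G : SimpleGraph V) (S : Set V) : ℕ :=
  sInf {k | Defendable m G S k}

/-- The four values of a parameter (`mvc` or `evc`) with respect to an edge `ab`: without a
prescribed vertex, with `a` prescribed, with `b` prescribed, and with both prescribed. -/
structure EdgeParams where
  free : ℤ
  fst : ℤ
  snd : ℤ
  both : ℤ

/-- The same parameters with respect to the edge `ba`. -/
def EdgeParams.swap (X : EdgeParams) : EdgeParams := ⟨X.free, X.snd, X.fst, X.both⟩

def EdgeParams.toList (X : EdgeParams) : List ℤ := [X.free, X.fst, X.snd, X.both]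

/-- The mvc parameters of the graph `G` with respect to the edge `ab`. -/
noncomputable def mvcParams {V : Type u} (G : SimpleGraph V) (a b : V) : EdgeParams :=
  ⟨mvc G ∅, mvc G {a}, mvc G {b}, mvc G {a, b}⟩

/-- The evc parameters of the graph `G` with respect to the edge `ab`. -/
noncomputable def evcParams {V : Type u} (m : GuardModel) (G : SimpleGraph V) (a b : V) :
    EdgeParams :=
  ⟨evc m G ∅, evc m G {a}, evc m G {b}, evc m G {a, b}⟩

/-! ## Outerplanar graphs -/

/-- An outerplanar embedding, as a drawing in a disc: the vertices are distinct points of the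
bounding circle, the edges are chords, and no two chords cross.  Thus all vertices are on the
exterior face.  Cutting the circle at a point that is not a vertex lists the vertices in
the order of `pos` (only this order matters); the chords `ab` and `cd` cross exactly if their
ends alternate. -/
structure OuterplanarEmbedding {V : Type u} (G : SimpleGraph V) where
  pos : V → ℕ
  pos_injective : Function.Injective pos
  noncrossing : ∀ a b c d, G.Adj a b → G.Adj c d →
    ¬ (pos a < pos c ∧ pos c < pos b ∧ pos b < pos d)

def IsOuterplanar {V : Type u} (G : SimpleGraph V) : Prop := Nonempty (OuterplanarEmbedding G)

/-- Outerplanar, and no edge can be added between existing vertices without destroying this. -/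
def IsMaximalOuterplanar {V : Type u} (G : SimpleGraph V) : Prop :=
  IsOuterplanar G ∧ ∀ H : SimpleGraph V, G < H → ¬ IsOuterplanar H

/-- The edge `ab` of the subgraph `H` is on the outer face of the drawing of `H` inherited from
the given embedding: it can be reached inside the disc from some point of the bounding circle
that is not a vertex without passing another edge.  The point is given by a cut `t`, lying
between the positions `< t` and the positions `≥ t`.  A chord `cd`, `pos c < pos d`, has the
circle points between `c` and `d` on one side and the remaining ones on the other; it does not
separate the point `t` from the chord `ab` exactly if either `t`, `a`, `b` are all on the first
(closed) side, or `t` is on the other side and so are `a` and `b`. -/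
def OuterplanarEmbedding.IsOuterEdge {V : Type u} {G : SimpleGraph V}
    (φ : OuterplanarEmbedding G) (H : G.Subgraph) (a b : V) : Prop :=
  H.Adj a b ∧ ∃ t : ℕ, ∀ c d, H.Adj c d → φ.pos c < φ.pos d → s(c, d) ≠ s(a, b) →
    ((φ.pos c < t ∧ t ≤ φ.pos d) ↔
      (φ.pos a ∈ Set.Icc (φ.pos c) (φ.pos d) ∧ φ.pos b ∈ Set.Icc (φ.pos c) (φ.pos d)))

/-- `H` is connected and has no cut vertex (a single edge is biconnected). -/
def IsBiconnected {V : Type u} {G : SimpleGraph V} (H : G.Subgraph) : Prop :=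
  H.Connected ∧ ∀ x ∈ H.verts, (H.deleteVerts {x}).Preconnected

/-- The subgraph `H` is the segment `G_a(ab)`, where `w` is the common neighbour of `a` and `b`:
the largest biconnected subgraph of `G` (outerplanar by the inherited embedding) that has
the edge `aw` on its outer face and does not contain `b`. -/
def OuterplanarEmbedding.IsSegment {V : Type u} {G : SimpleGraph V}
    (φ : OuterplanarEmbedding G) (a b w : V) (H : G.Subgraph) : Prop :=
  IsGreatest {K : G.Subgraph | IsBiconnected K ∧ φ.IsOuterEdge K a w ∧ b ∉ K.verts} H

/-! ## A register machine with unit-cost steps -/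

/-- Instructions of a machine with integer registers `0, 1, 2, …`. -/
inductive Instr
  | const (r : ℕ) (c : ℤ)
  | add (r s t : ℕ)
  | sub (r s t : ℕ)
  | jumpLE (s t target : ℕ)

structure State where
  pc : ℕ
  reg : ℕ → ℤ

/-- `const r c`: put the constant `c` into register `r`; `add r s t`, `sub r s t`: put the sum,
the difference, of the registers `s` and `t` into register `r`; `jumpLE s t target`: continue at
instruction `target` if register `s` is at most register `t`, otherwise with the next one. -/
def Instr.exec : Instr → State → State
  | .const r c, z => ⟨z.pc + 1, Function.update z.reg r c⟩
  | .add r s t, z => ⟨z.pc + 1, Function.update z.reg r (z.reg s + z.reg t)⟩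
  | .sub r s t, z => ⟨z.pc + 1, Function.update z.reg r (z.reg s - z.reg t)⟩
  | .jumpLE s t target, z => ⟨if z.reg s ≤ z.reg t then target else z.pc + 1, z.reg⟩

/-- A program is a fixed finite list of instructions; the machine halts, and then keeps its
state, when the program counter leaves the list. -/
abbrev Program := List Instr

def Program.step (P : Program) (z : State) : State :=
  match P[z.pc]? with
  | some i => i.exec z
  | none => z

/-- Started at instruction `0` with the input in the first registers and `0` in all others, `P`
halts after at most `T` steps with the output in the first registers. -/
def Program.ComputesWithin (P : Program) (T : ℕ) (input output : List ℤ) : Prop :=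
  let z := P.step^[T] ⟨0, fun i => input.getD i 0⟩
  P.length ≤ z.pc ∧ ∀ i (h : i < output.length), z.reg i = output[i]

/-! ## The formulas

`Mu`, `Eu` are the mvc and evc parameters of the segment at `u` with respect to `uw`, and `Mv`,
`Ev` those of the segment at `v` with respect to `vw`; so `fst` refers to `u` (respectively `v`)
and `snd` refers to `w`.  `M` and `E` are the mvc and evc parameters of the whole graph with
respect to `uv`.  Since `evc` is `mvc` or `mvc + 1` for each segment, there are four cases; one of
the two mixed cases is the mirror image of the other. -/

/-- `mvc` of the whole graph. -/
def mvcFormula (Mu Mv : EdgeParams) : ℤ :=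
  min (Mu.snd + Mv.both - 1) (min (Mu.both + Mv.snd - 1) (Mu.free + Mv.free))

/-- `evc` of the whole graph, whose `mvc` is `μ`, if `evc = mvc` for the segment at `u` and
`evc = mvc + 1` for the segment at `v`. -/
def evcMixed (μ : ℤ) (Mu Eu Ev : EdgeParams) : ℤ :=
  min (μ + 1) (min (Eu.free + Ev.both - 1) (Mu.both + Ev.snd - 1))

/-- `evc` of the whole graph, whose `mvc` is `μ`. -/
def evcFormula (μ : ℤ) (Mu Eu Mv Ev : EdgeParams) : ℤ :=
  if Eu.free = Mu.free then
    if Ev.free = Mv.free then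
      max (Eu.snd + Mv.free - 1) (Mu.free + Ev.snd - 1)
    else evcMixed μ Mu Eu Ev
  else
    if Ev.free = Mv.free then evcMixed μ Mv Ev Eu
    else min (μ + 1) (max (Eu.both + Mv.snd - 1) (Mu.snd + Ev.both - 1))

/-- The parameters `evc_u`, `evc_v`, `evc_uv` of a graph with respect to the edge `uv`. -/
structure EndParams where
  atFst : ℤ
  atSnd : ℤ
  atBoth : ℤ

def EndParams.swap (X : EndParams) : EndParams := ⟨X.atSnd, X.atFst, X.atBoth⟩

def EndParams.toList (X : EndParams) : List ℤ := [X.atFst, X.atSnd, X.atBoth]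

/-- The case `evc = mvc` for both segments; `ε` is `evc` of the whole graph. -/
def endsTight (ε : ℤ) (M Mu Eu Mv Ev : EdgeParams) : EndParams :=
  if ε = Mu.free + Mv.free - 1 then
    ⟨Eu.both + Mv.free - 1, Ev.both + Mu.free - 1, min (M.both + 1) (Eu.both + Ev.both - 1)⟩
  else
    ⟨ε, ε, min (Eu.fst + Mv.free) (min (Ev.fst + Mu.free) (M.both + 1))⟩

/-- The case `evc = mvc` for the segment at `u` and `evc = mvc + 1` for the segment at `v`. -/
def endsMixed (ε : ℤ) (M Mu Eu Mv Ev : EdgeParams) : EndParams :=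
  if M.free = Mu.free + Mv.free - 1 then
    ⟨Mu.both + Ev.free - 1,
      min (M.snd + 1) (min (Eu.snd + Ev.both - 1)
        (max (Mu.snd + Ev.both - 1) (Eu.free + Mv.fst))),
      min (M.both + 1) (min (Eu.both + Ev.both - 1) (Eu.fst + max (Ev.both - 1) Mv.fst))⟩
  else if ε = Mu.free + Mv.free then
    ⟨Eu.fst + Ev.snd - 1,
      min (M.snd + 1) (min (Eu.snd + Ev.both - 1)
        (max (Mu.snd + Ev.both - 1) (Eu.free + Mv.fst))),
      min (ε + 1) (max (Eu.fst + Mv.fst) (Eu.fst + Ev.both - 1))⟩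
  else
    ⟨ε, ε, min (M.both + 1) (Eu.free + Ev.fst)⟩

/-- The case `evc = mvc + 1` for both segments. -/
def endsSlack (M Mu Eu Mv Ev : EdgeParams) : EndParams :=
  ⟨min (M.fst + 1) (Eu.fst + Ev.snd - 1),
    min (M.snd + 1) (Ev.fst + Eu.snd - 1),
    if M.both ≤ Mu.free + Mv.free then M.both + 1
    else min (M.both + 1)
      (max (min (Eu.both + Mv.both - 1) (Eu.fst + Mv.fst))
        (min (Mu.both + Ev.both - 1) (Mu.fst + Ev.fst)))⟩

/-- `evc_u`, `evc_v` and `evc_uv` of the whole graph, whose `evc` is `ε`. -/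
def endsFormula (ε : ℤ) (M Mu Eu Mv Ev : EdgeParams) : EndParams :=
  if Eu.free = Mu.free then
    if Ev.free = Mv.free then endsTight ε M Mu Eu Mv Ev
    else endsMixed ε M Mu Eu Mv Ev
  else
    if Ev.free = Mv.free then (endsMixed ε M.swap Mv Ev Mu Eu).swap
    else endsSlack M Mu Eu Mv Ev

/-- The case distinction of the formulas is exhaustive: each of the tests in them decides between
two possible values. -/
def CasesExhaustive (μ ε : ℤ) (Mu Eu Mv Ev : EdgeParams) : Prop :=
  (Eu.free = Mu.free ∨ Eu.free = Mu.free + 1) ∧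
  (Ev.free = Mv.free ∨ Ev.free = Mv.free + 1) ∧
  (Eu.free = Mu.free → Ev.free = Mv.free →
    ε = Mu.free + Mv.free - 1 ∨ ε = Mu.free + Mv.free) ∧
  (¬ (Eu.free = Mu.free ↔ Ev.free = Mv.free) →
    μ = Mu.free + Mv.free - 1 ∨
      (μ = Mu.free + Mv.free ∧ (ε = Mu.free + Mv.free ∨ ε = Mu.free + Mv.free + 1)))

/-- All claims about a graph with the edge `uv`, its parameters `M`, `E` and those of its two
segments: the exhaustive case distinction, the explicit formulas, and the computation of `evc` by the program `P` and of the
remaining three evc parameters by the program `Q`, both within `T` steps. -/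
def DeterminedWithin (P Q : Program) (T : ℕ) (M E Mu Eu Mv Ev : EdgeParams) : Prop :=
  CasesExhaustive M.free E.free Mu Eu Mv Ev ∧
  M.free = mvcFormula Mu Mv ∧
  E.free = evcFormula M.free Mu Eu Mv Ev ∧
  (⟨E.fst, E.snd, E.both⟩ : EndParams) = endsFormula E.free M Mu Eu Mv Ev ∧
  P.ComputesWithin T (Mu.toList ++ Eu.toList ++ Mv.toList ++ Ev.toList) [E.free] ∧
  Q.ComputesWithin T
    (E.free :: M.toList ++ Mu.toList ++ Eu.toList ++ Mv.toList ++ Ev.toList)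
    [E.fst, E.snd, E.both]

end EternalCover

/-!
The proof reduces the game to vertex covers. Suppose that every vertex cover of a finite graph `H`
without isolated vertices is connected. Then `evc_S(H)` is the maximum of `mvc_{S ∪ {x}}(H)` over
all vertices `x` (`isGreatest_evc`), in both models. An attack on an edge at `x` forces a guard
onto `x`, so that many guards are needed. They also suffice: if the maximum exceeds `mvc_S(H)`,
it does so by `1`, and a spare guard can be pushed along a path through a fixed minimum cover.
If it equals `mvc_S(H)`, the guards move from a minimum cover `C` to a minimum cover `C'` that
contains the attacked unguarded vertex `b` and is as close to `C` as possible. Minimality of `C'`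
gives a surplus in Hall's condition (`exists_cover_with_matchings`), so that any one guard of
`C \ C'` can be used for the shift along a path towards `b`, while the others are matched into
`C' \ C`.

A maximal outerplanar graph is a triangulated polygon (`IsMaximalOuterplanar.triangulated`): over
every edge with vertices between its ends there is a triangle with its apex among them. By
recursion along these triangles, all vertex covers are connected (`Triangulated.connected_cover`)
and there are no cut vertices (`Triangulated.connected_diff`). The apex over the outer edge `uv`
is the common neighbour `w`, and the polygons over `uw` and `vw` are the two segments
(`SplitsAt.isSegment`).

Since a cover contains two of `u`, `v`, `w`, the mvc parameters of the graph, with any further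
vertex `x` prescribed, are given by those of the segments through the function `glue`
(`SplitsAt.paramsOf_mvc`). The parameters of a segment, with and without a further prescribed
vertex, obey a few inequalities (`IsProfile`) that leave finitely many possibilities up to an
additive constant. Every evc parameter is a maximum of mvc parameters over the vertex `x`, so each
of the asserted formulas is an identity between these finitely many configurations, which is
checked by evaluation (`determined_of_normal`).

The programs arise from the formulas by compilation of expressions with additions, subtractions
and comparisons into code whose jumps all lead forward (`Expr.evaluates_compile`).
-/

namespace EternalCover

open SimpleGraph

/-! ### Vertex covers of prescribed content -/

section Mvc

variable {V : Type u} {G : SimpleGraph V}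

lemma mvc_le {S : Set V} {C : Finset V} (hC : G.IsVertexCover (C : Set V)) (hS : S ⊆ C) :
    mvc G S ≤ C.card :=
  Nat.sInf_le ⟨C, rfl, hC, hS⟩

variable [Finite V]

lemma exists_card_eq_mvc (G : SimpleGraph V) (S : Set V) :
    ∃ C : Finset V, C.card = mvc G S ∧ G.IsVertexCover (C : Set V) ∧ S ⊆ C := by
  have := Fintype.ofFinite V
  exact Nat.sInf_mem (s := {k | ∃ C : Finset V, C.card = k ∧ G.IsVertexCover (C : Set V) ∧
    S ⊆ (C : Set V)}) ⟨_, Finset.univ, rfl, by simp, by simp⟩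

lemma mvc_mono {S T : Set V} (h : S ⊆ T) : mvc G S ≤ mvc G T := by
  obtain ⟨C, hc, hC, hT⟩ := exists_card_eq_mvc G T
  exact hc ▸ mvc_le hC (h.trans hT)

lemma mvc_insert_le (S : Set V) (x : V) : mvc G (insert x S) ≤ mvc G S + 1 := by
  classical
  obtain ⟨C, hc, hC, hS⟩ := exists_card_eq_mvc G S
  refine (mvc_le (C := insert x C) (hC.subset (by simp)) ?_).trans
    (hc ▸ Finset.card_insert_le x C)
  rw [Finset.coe_insert]
  exact Set.insert_subset_insert hS

/-- A cover contains an end of every edge, so prescribing the better end costs nothing. -/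
lemma mvc_eq_min_of_adj (S : Set V) {a b : V} (hab : G.Adj a b) :
    mvc G S = min (mvc G (insert a S)) (mvc G (insert b S)) := by
  apply le_antisymm
  · exact le_min (mvc_mono (Set.subset_insert _ _)) (mvc_mono (Set.subset_insert _ _))
  · obtain ⟨C, hc, hC, hS⟩ := exists_card_eq_mvc G S
    rcases hC hab with h | h
    · exact (min_le_left _ _).trans (hc ▸ mvc_le hC (Set.insert_subset h hS))
    · exact (min_le_right _ _).trans (hc ▸ mvc_le hC (Set.insert_subset h hS))

end Mvc

/-! ### Moving the guards between two covers -/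

section Moves

variable {V : Type u} {G : SimpleGraph V}

/-- Along a path from `a` into `T`, guards can be pushed towards a vertex `b` adjacent to `a`:
the permutation `f` sends every vertex of an initial segment of the path to its predecessor,
`a` to `b`, and (closing the cycle) `b` to the first vertex `w` of `T` on the path. -/
lemma exists_perm_shift [DecidableEq V] (T : Set V) {a w₀ : V} (p : G.Walk a w₀) (hp : p.IsPath)
    (hw₀ : w₀ ∈ T) (b : V) (hb : b ∉ p.support) (hbT : b ∉ T) (hab : G.Adj a b) :
    ∃ (f : Equiv.Perm V) (w : V), w ∈ T ∧ w ∈ p.support ∧ f a = b ∧ f b = w ∧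
      (∀ x, x ≠ b → f x = x ∨ G.Adj x (f x)) ∧
      (∀ x, x ∉ p.support → x ≠ b → f x = x) ∧ ∀ x ∈ T, x ≠ w → f x = x := by
  induction p generalizing b with
  | nil =>
    rename_i a
    simp only [Walk.support_nil, List.mem_singleton] at hb ⊢
    refine ⟨Equiv.swap a b, a, hw₀, rfl, by simp, by simp, fun x hx => ?_,
      fun x h1 h2 => Equiv.swap_apply_of_ne_of_ne h1 h2,
      fun x h1 h2 => Equiv.swap_apply_of_ne_of_ne h2 (by rintro rfl; exact hbT h1)⟩
    by_cases h : x = a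
    · subst h; right; simpa using hab
    · left; exact Equiv.swap_apply_of_ne_of_ne h hx
  | cons h q ih =>
    rename_i a a' w₀
    rw [Walk.cons_isPath_iff] at hp
    simp only [Walk.support_cons, List.mem_cons, not_or] at hb ⊢
    by_cases haT : a ∈ T
    · refine ⟨Equiv.swap a b, a, haT, Or.inl rfl, by simp, by simp, fun x hx => ?_,
        fun x h1 h2 => Equiv.swap_apply_of_ne_of_ne h1.1 h2,
        fun x h1 h2 => Equiv.swap_apply_of_ne_of_ne h2 (by rintro rfl; exact hbT h1)⟩
      by_cases h : x = a
      · subst h; right; simpa using hab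
      · left; exact Equiv.swap_apply_of_ne_of_ne h hx
    · obtain ⟨f, w, hwT, hws, h1, h2, h3, h4, h5⟩ := ih hp.1 hw₀ a hp.2 haT h.symm
      have hfb : f b = b := h4 b hb.2 hb.1
      refine ⟨f * Equiv.swap a b, w, hwT, Or.inr hws, by simpa using hfb, by simpa using h2,
        fun x hx => ?_, fun x hx hxb => ?_, fun x hx hxw => ?_⟩
      · by_cases hxa : x = a
        · subst hxa; right; simpa [hfb] using hab
        · rw [Equiv.Perm.mul_apply, Equiv.swap_apply_of_ne_of_ne hxa hx]
          exact h3 x hxa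
      · rw [Equiv.Perm.mul_apply, Equiv.swap_apply_of_ne_of_ne hx.1 hxb]
        exact h4 x hx.2 hx.1
      · have hxa : x ≠ a := by rintro rfl; exact haT hx
        have hxb : x ≠ b := by rintro rfl; exact hbT hx
        rw [Equiv.Perm.mul_apply, Equiv.swap_apply_of_ne_of_ne hxa hxb]
        exact h5 x hx hxw

/-- In a connected set `C`, guards can be pushed from some vertex `w` of `T ⊆ C` along a path
to a given vertex `a ∈ C` and on to `b ∉ C`, disturbing no other vertex of `T`. -/
lemma exists_perm_shift_of_connected [DecidableEq V] {C T : Set V} (hC : (G.induce C).Connected)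
    (hTC : T ⊆ C) (hT : T.Nonempty) {a b : V} (ha : a ∈ C) (hb : b ∉ C) (hab : G.Adj a b) :
    ∃ (f : Equiv.Perm V) (w : V), w ∈ T ∧ f a = b ∧ f b = w ∧
      (∀ x ∈ C, f x = x ∨ G.Adj x (f x)) ∧ (∀ x ∈ C, x ≠ a → f x ∈ C) ∧
      ∀ x ∈ T, x ≠ w → f x = x := by
  obtain ⟨w₀, hw₀⟩ := hT
  obtain ⟨p, hp⟩ := (hC.preconnected ⟨a, ha⟩ ⟨w₀, hTC hw₀⟩).exists_isPath
  set q := p.map (Embedding.induce C).toHom with hq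
  have hqp : q.IsPath := hp.map (Embedding.induce (G := G) C).injective
  have hqs : ∀ x ∈ q.support, x ∈ C := by
    intro x hx
    rw [hq, Walk.support_map, List.mem_map] at hx
    obtain ⟨y, -, rfl⟩ := hx
    exact y.2
  obtain ⟨f, w, h1, -, h3, h4, h5, h6, h7⟩ := exists_perm_shift T q hqp hw₀ b
    (fun h => hb (hqs b h)) (fun h => hb (hTC h)) hab
  refine ⟨f, w, h1, h3, h4, fun x hx => h5 x (by rintro rfl; exact hb hx), fun x hx hxa => ?_, h7⟩
  by_contra hfx
  have hfb : f x ≠ b := fun h => hxa (f.injective (h.trans h3.symm))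
  -- `f x` is off the path, hence fixed, hence equal to `x`
  have := f.injective (h6 (f x) (fun h => hfx (hqs _ h)) hfb)
  exact hfx (by rwa [this])

/-- From a minimum cover `C ⊇ S` towards a vertex `b` that belongs to some cover `C' ⊇ S` of the
same size.  Choosing `C'` as close to `C` as possible gives the bipartite graph between `C \ C'`
and `C' \ C` so much surplus in Hall's condition that it has, for every `w ∈ C \ C'`, a matching
of `C \ (C' ∪ {w})` into `C' \ (C ∪ {b})`. -/
lemma exists_cover_with_matchings [Finite V] [DecidableEq V] {S : Set V} {C : Finset V}
    (hC : G.IsVertexCover (C : Set V)) (hS : S ⊆ C) {b : V} (hbC : b ∉ C)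
    (hm : mvc G (insert b S) = C.card) :
    ∃ C' : Finset V, C'.card = C.card ∧ G.IsVertexCover (C' : Set V) ∧ S ⊆ C' ∧ b ∈ C' ∧
      ∀ w ∈ C \ C', ∃ M : V → V, (∀ x ∈ C \ C', x ≠ w → M x ∈ (C' \ C).erase b ∧ G.Adj x (M x)) ∧
        Set.InjOn M {x | x ∈ C \ C' ∧ x ≠ w} := by
  have := Fintype.ofFinite V
  classical
  -- a cover at least distance from `C`
  let F : Finset (Finset V) := Finset.univ.filter fun D =>
    D.card = C.card ∧ G.IsVertexCover (D : Set V) ∧ insert b S ⊆ (D : Set V)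
  have hF : F.Nonempty := by
    obtain ⟨D, h1, h2, h3⟩ := exists_card_eq_mvc G (insert b S)
    exact ⟨D, by simp only [F, Finset.mem_filter, Finset.mem_univ, true_and]
                 exact ⟨h1.trans hm, h2, h3⟩⟩
  obtain ⟨C', hC'F, hmin⟩ := F.exists_min_image (fun D => (D \ C).card) hF
  simp only [F, Finset.mem_filter, Finset.mem_univ, true_and] at hC'F hmin
  obtain ⟨hcard, hC', hbS⟩ := hC'F
  have hbC' : b ∈ C' := hbS (Set.mem_insert _ _)
  have hSC' : S ⊆ C' := fun x hx => hbS (Set.mem_insert_of_mem _ hx)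
  refine ⟨C', hcard, hC', hSC', hbC', fun w hw => ?_⟩
  have hdiff : (C' \ C).card = (C \ C').card := by
    have h1 := Finset.card_sdiff_add_card_inter C' C
    have h2 := Finset.card_sdiff_add_card_inter C C'
    rw [Finset.inter_comm] at h2
    omega
  have hbmem : b ∈ C' \ C := by simp [hbC, hbC']
  let t : {x // x ∈ (C \ C').erase w} → Finset V := fun x =>
    ((C' \ C).erase b).filter fun y => G.Adj x y
  have hall : ∀ X : Finset {x // x ∈ (C \ C').erase w}, X.card ≤ (X.biUnion t).card := by
    intro X
    set X' : Finset V := X.map (Function.Embedding.subtype _) with hX'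
    have hX'T : X' ⊆ (C \ C').erase w := by
      intro x hx
      simp only [hX', Finset.mem_map, Function.Embedding.subtype_apply] at hx
      obtain ⟨y, -, rfl⟩ := hx
      exact y.2
    have hXc : X'.card = X.card := Finset.card_map _
    set N := X.biUnion t with hN
    have hNsub : N ⊆ (C' \ C).erase b := by
      intro y hy
      simp only [hN, Finset.mem_biUnion, t, Finset.mem_filter] at hy
      obtain ⟨x, -, h, -⟩ := hy
      exact h
    -- replacing the unmatched part `Y` of `C' \ C` by the vertices of `C \ C'` outside `X`
    -- gives another cover
    set Y := (C' \ C).erase b \ N with hY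
    have hYcard : Y.card + N.card + 1 = (C \ C').card := by
      have h1 := Finset.card_sdiff_add_card_eq_card hNsub
      have h2 := Finset.card_erase_add_one hbmem
      rw [← hY] at h1
      omega
    by_cases hYe : Y = ∅
    · rw [hYe, Finset.card_empty] at hYcard
      have h1 := Finset.card_le_card hX'T
      have h2 := Finset.card_erase_add_one hw
      omega
    have hYpos : 0 < Y.card := Finset.card_pos.2 (Finset.nonempty_iff_ne_empty.2 hYe)
    have hYsub : Y ⊆ C' \ C := Finset.sdiff_subset.trans (Finset.erase_subset _ _)
    set D := (C' \ Y) ∪ ((C \ C') \ X') with hD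
    have hDS : insert b S ⊆ (D : Set V) := by
      intro x hx
      have hxC' : x ∈ C' := hbS hx
      have hxY : x ∉ Y := by
        intro h
        rcases hx with rfl | hx
        · simp [hY] at h
        · exact (Finset.mem_sdiff.1 (hYsub h)).2 (hS hx)
      simp [hD, hxC', hxY]
    have hDhalf : ∀ x y, G.Adj x y → x ∈ C' → x ∈ D ∨ y ∈ D := by
      intro x y hxy hx
      by_cases hxY : x ∈ Y
      · right
        have hxC : x ∉ C := (Finset.mem_sdiff.1 (hYsub hxY)).2
        have hyC : y ∈ C := (hC hxy).resolve_left hxC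
        by_cases hyC' : y ∈ C'
        · have : y ∉ Y := fun h => (Finset.mem_sdiff.1 (hYsub h)).2 hyC
          simp [hD, hyC', this]
        · have : y ∉ X' := by
            intro h
            simp only [hX', Finset.mem_map, Function.Embedding.subtype_apply] at h
            obtain ⟨z, hz, rfl⟩ := h
            refine (Finset.mem_sdiff.1 hxY).2 ?_
            simp only [hN, Finset.mem_biUnion, t, Finset.mem_filter]
            exact ⟨z, hz, (Finset.mem_sdiff.1 hxY).1, hxy.symm⟩
          simp [hD, hyC, hyC', this]
      · left; simp [hD, hx, hxY]
    have hDcov : G.IsVertexCover (D : Set V) := by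
      intro x y hxy
      rcases hC' hxy with h | h
      · exact hDhalf x y hxy h
      · exact (hDhalf y x hxy.symm h).symm
    have hDcard : D.card + Y.card + X'.card = C'.card + (C \ C').card := by
      have hdisj : Disjoint (C' \ Y) ((C \ C') \ X') := by
        rw [Finset.disjoint_left]
        intro x hx hx'
        simp only [Finset.mem_sdiff] at hx hx'
        exact hx'.1.2 hx.1
      have h1 := Finset.card_union_of_disjoint hdisj
      have h2 := Finset.card_sdiff_add_card_eq_card (hYsub.trans Finset.sdiff_subset)
      have h3 := Finset.card_sdiff_add_card_eq_card (hX'T.trans (Finset.erase_subset _ _))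
      rw [← hD] at h1
      omega
    have hDge : C.card ≤ D.card := hm ▸ mvc_le hDcov hDS
    by_contra hlt
    push Not at hlt
    have hDeq : D.card = C.card := by omega
    have h1 := hmin D ⟨hDeq, hDcov, hDS⟩
    have h2 : D \ C ⊆ (C' \ C) \ Y := by
      intro x hx
      simp only [hD, Finset.mem_sdiff, Finset.mem_union] at hx ⊢
      tauto
    have h3 := Finset.card_le_card h2
    have h4 := Finset.card_sdiff_add_card_eq_card hYsub
    omega
  obtain ⟨g, hginj, hg⟩ := (Finset.all_card_le_biUnion_card_iff_exists_injective t).1 hall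
  have hmem : ∀ x, x ∈ C \ C' → x ≠ w → x ∈ (C \ C').erase w :=
    fun x h1 h2 => Finset.mem_erase.2 ⟨h2, h1⟩
  refine ⟨fun x => if h : x ∈ (C \ C').erase w then g ⟨x, h⟩ else x, fun x h1 h2 => ?_, ?_⟩
  · have := hg ⟨x, hmem x h1 h2⟩
    simp only [t, Finset.mem_filter] at this
    simpa only [dif_pos (hmem x h1 h2)] using this
  · rintro x ⟨h1, h2⟩ y ⟨h3, h4⟩ hxy
    simp only [dif_pos (hmem x h1 h2), dif_pos (hmem y h3 h4)] at hxy
    exact congrArg Subtype.val (hginj hxy)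

/-- `C'` is reached from `C` by a legal move of the guards, one per vertex, that defends `ab`. -/
def CoverMove (G : SimpleGraph V) (C C' : Finset V) (a b : V) : Prop :=
  ∃ f : V → V, Set.InjOn f C ∧ (∀ x ∈ C, f x ∈ C') ∧ (∀ x ∈ C, f x = x ∨ G.Adj x (f x)) ∧ f a = b

/-- A family of covers that are closed under defending moves yields a strategy. -/
lemma defendable_of_family (m : GuardModel) (S : Set V) (k : ℕ) (F : Finset V → Prop)
    (hne : ∃ C, F C) (hF : ∀ C, F C → C.card = k ∧ G.IsVertexCover (C : Set V) ∧ S ⊆ C)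
    (hmove : ∀ C, F C → ∀ a b, G.Adj a b → a ∈ C → b ∉ C → ∃ C', F C' ∧ CoverMove G C C' a b) :
    Defendable m G S k := by
  classical
  let Cfg := {p : Fin k → V // Function.Injective p ∧ F (Finset.univ.image p)}
  have hcfg : ∀ C, F C → ∃ p : Cfg, Finset.univ.image p.1 = C := by
    intro C hC
    let e := C.equivFinOfCardEq (hF C hC).1
    have him : Finset.univ.image (fun i => (e.symm i : V)) = C := by
      ext x
      simp only [Finset.mem_image, Finset.mem_univ, true_and]
      exact ⟨by rintro ⟨i, rfl⟩; exact (e.symm i).2, fun h => ⟨e ⟨x, h⟩, by simp⟩⟩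
    exact ⟨⟨fun i => e.symm i, Subtype.val_injective.comp e.symm.injective, by rwa [him]⟩, him⟩
  have hstep : ∀ (p : Cfg) (e : G.edgeSet), ∃ q : Cfg, Defends G e.1 p.1 q.1 := by
    rintro ⟨p, hp, hpF⟩ ⟨e, he⟩
    have hmem : ∀ i, p i ∈ Finset.univ.image p := fun i => Finset.mem_image_of_mem _ (by simp)
    have key : ∀ a b, G.Adj a b → a ∈ Finset.univ.image p →
        ∃ q : Cfg, Defends G s(a, b) p q.1 := by
      intro a b hab ha
      obtain ⟨i₀, -, hi₀⟩ := Finset.mem_image.1 ha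
      obtain ⟨C', hC', f, hinj, hmap, hadj, hfa⟩ :
          ∃ C', F C' ∧ CoverMove G (Finset.univ.image p) C' a b := by
        by_cases hb : b ∈ Finset.univ.image p
        -- both ends are guarded: the two guards change places
        · refine ⟨_, hpF, Equiv.swap a b, (Equiv.injective _).injOn, fun x hx => ?_,
            fun x hx => ?_, by simp⟩
          · by_cases hxa : x = a
            · subst hxa; simpa using hb
            · by_cases hxb : x = b
              · subst hxb; simpa using ha
              · rwa [Equiv.swap_apply_of_ne_of_ne hxa hxb]
          · by_cases hxa : x = a
            · subst hxa; right; simpa using hab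
            · by_cases hxb : x = b
              · subst hxb; right; simpa using hab.symm
              · left; exact Equiv.swap_apply_of_ne_of_ne hxa hxb
        · exact hmove _ hpF a b hab ha hb
      have hqinj : Function.Injective (f ∘ p) := fun i j h =>
        hp (hinj (by exact_mod_cast hmem i) (by exact_mod_cast hmem j) h)
      have him : Finset.univ.image (f ∘ p) = C' := by
        apply Finset.eq_of_subset_of_card_le
        · intro x hx
          obtain ⟨i, -, rfl⟩ := Finset.mem_image.1 hx
          exact hmap _ (hmem i)
        · rw [(hF C' hC').1, Finset.card_image_of_injective _ hqinj]
          simp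
      refine ⟨⟨f ∘ p, hqinj, him ▸ hC'⟩, fun i => hadj _ (hmem i), i₀, ?_⟩
      simp [hi₀, hfa]
    induction e with
    | h a b =>
      have hab : G.Adj a b := he
      rcases (hF _ hpF).2.1 hab with h | h
      · exact key a b hab (by exact_mod_cast h)
      · obtain ⟨q, hq⟩ := key b a hab.symm (by exact_mod_cast h)
        rw [Sym2.eq_swap] at hq
        exact ⟨q, hq⟩
  choose next hnext using hstep
  obtain ⟨C₀, hC₀⟩ := hne
  obtain ⟨p₀, -⟩ := hcfg C₀ hC₀
  let σ : List G.edgeSet → Cfg := fun h => h.foldr (fun e p => next p e) p₀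
  refine ⟨fun h => (σ h).1, fun h => ?_, fun h e => hnext (σ h) e⟩
  have := hF _ (σ h).2.2
  rw [Finset.coe_image, Finset.coe_univ, Set.image_univ] at this
  exact ⟨this.2.1, this.2.2, fun _ => (σ h).2.1⟩

end Moves

/-! ### The eternal vertex cover number when all vertex covers are connected -/

section Evc

variable {V : Type u} {G : SimpleGraph V}

/-- Attacking an edge at `x` forces a guard onto `x`, before or after the move. -/
lemma mvc_insert_le_of_defendable {m : GuardModel} {S : Set V} {k : ℕ} (h : Defendable m G S k)
    {x y : V} (hxy : G.Adj x y) : mvc G (insert x S) ≤ k := by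
  classical
  obtain ⟨σ, hσ, hd⟩ := h
  have key : ∀ h, x ∈ Set.range (σ h) → mvc G (insert x S) ≤ k := by
    intro h hx
    have := mvc_le (G := G) (S := insert x S) (C := Finset.univ.image (σ h))
      (by simpa using (hσ h).1) (by simpa using Set.insert_subset hx (hσ h).2.1)
    exact this.trans (Finset.card_image_le.trans (by simp))
  obtain ⟨-, i, hi⟩ := hd [] ⟨s(x, y), hxy⟩
  have hx : x ∈ s(σ [] i, σ [⟨s(x, y), hxy⟩] i) := by rw [hi]; exact Sym2.mem_mk_left x y
  rcases Sym2.mem_iff.1 hx with h | h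
  · exact key _ ⟨i, h.symm⟩
  · exact key _ ⟨i, h.symm⟩

variable [Finite V]

/-- The number of guards suffices: if it is `mvc G S`, the guards move between minimum covers, and
otherwise a spare guard patrols a fixed minimum cover. -/
lemma defendable_of_forall_mvc_insert_le (m : GuardModel) {S : Set V} {k : ℕ}
    (hconn : ∀ C : Finset V, G.IsVertexCover (C : Set V) → (G.induce (C : Set V)).Connected)
    (hk : ∀ x, mvc G (insert x S) ≤ k) (hk' : ∃ x, mvc G (insert x S) = k) :
    Defendable m G S k := by
  classical
  obtain ⟨x₀, hx₀⟩ := hk'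
  obtain ⟨C₀, hc₀, hC₀, hS₀⟩ := exists_card_eq_mvc G S
  have hle : mvc G S ≤ k := hx₀ ▸ mvc_mono (Set.subset_insert _ _)
  rcases hle.eq_or_lt with heq | hlt
  · -- all minimum covers containing `S` are admissible
    refine defendable_of_family m S k
      (fun C => C.card = k ∧ G.IsVertexCover (C : Set V) ∧ S ⊆ C) ⟨C₀, hc₀.trans heq, hC₀, hS₀⟩
      (fun C h => h) ?_
    rintro C ⟨hc, hC, hS⟩ a b hab ha hb
    have hm : mvc G (insert b S) = C.card :=
      le_antisymm ((hk b).trans hc.ge) (hc.le.trans (heq ▸ mvc_mono (Set.subset_insert _ _)))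
    obtain ⟨C', hc', hC', hS', hbC', hM⟩ := exists_cover_with_matchings hC hS hb hm
    have hT : (C \ C').Nonempty := by
      rw [Finset.sdiff_nonempty]
      intro hsub
      exact hb (Finset.eq_of_subset_of_card_le hsub hc'.le ▸ hbC')
    obtain ⟨f, w, hw, hfa, hfb, hfadj, hfC, hfT⟩ := exists_perm_shift_of_connected
      (T := ((C \ C' : Finset V) : Set V)) (hconn C hC) (by simp) (by exact_mod_cast hT)
      (by exact_mod_cast ha) (by exact_mod_cast hb) hab
    have hw' : w ∈ C \ C' := by exact_mod_cast hw
    obtain ⟨M, hM1, hM2⟩ := hM w hw'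
    -- a guard that is not moved by `M` ends in `C ∩ C'` or on `b`, so clashes with no other guard
    have hfC' : ∀ x ∈ C, ¬ (x ∈ C \ C' ∧ x ≠ w) → f x ∈ C' ∧ (f x ∈ C ∨ f x = b) := by
      intro x hx hxT
      by_cases hxa : x = a
      · subst hxa; rw [hfa]; exact ⟨hbC', Or.inr rfl⟩
      · have h1 : f x ∈ C := by exact_mod_cast hfC x (by exact_mod_cast hx) hxa
        refine ⟨by_contra fun h2 => ?_, Or.inl h1⟩
        have h3 : f x ∈ C \ C' := Finset.mem_sdiff.2 ⟨h1, h2⟩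
        have h4 : f x ≠ w := fun h => hb (f.injective (h.trans hfb.symm) ▸ hx)
        have h5 := f.injective (hfT (f x) (by exact_mod_cast h3) h4)
        exact hxT ⟨h5 ▸ h3, h5 ▸ h4⟩
    have hMb : ∀ x, x ∈ C \ C' ∧ x ≠ w → M x ∈ C' ∧ M x ∉ C ∧ M x ≠ b ∧ G.Adj x (M x) := by
      rintro x ⟨h1, h2⟩
      obtain ⟨h3, h4⟩ := hM1 x h1 h2
      simp only [Finset.mem_erase, Finset.mem_sdiff] at h3
      exact ⟨h3.2.1, h3.2.2, h3.1, h4⟩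
    refine ⟨C', ⟨hc'.trans hc, hC', hS'⟩, fun x => if x ∈ C \ C' ∧ x ≠ w then M x else f x,
      ?_, ?_, ?_, ?_⟩
    · intro x hx y hy hxy
      have hx : x ∈ C := by exact_mod_cast hx
      have hy : y ∈ C := by exact_mod_cast hy
      dsimp only at hxy
      split_ifs at hxy with h1 h2 h2
      · exact hM2 h1 h2 hxy
      · rcases (hfC' y hy h2).2 with h | h
        · exact absurd (hxy ▸ h) (hMb x h1).2.1
        · exact absurd (hxy.trans h) (hMb x h1).2.2.1
      · rcases (hfC' x hx h1).2 with h | h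
        · exact absurd (hxy ▸ h) (hMb y h2).2.1
        · exact absurd (hxy.symm.trans h) (hMb y h2).2.2.1
      · exact f.injective hxy
    · intro x hx
      dsimp only
      split_ifs with h1
      · exact (hMb x h1).1
      · exact (hfC' x hx h1).1
    · intro x hx
      dsimp only
      split_ifs with h1
      · exact Or.inr (hMb x h1).2.2.2
      · exact hfadj x (by exact_mod_cast hx)
    · have : ¬ (a ∈ C \ C' ∧ a ≠ w) := by
        rintro ⟨h1, h2⟩
        have := hfT a (by exact_mod_cast h1) h2
        exact hab.ne (this.symm.trans hfa)
      simp only [if_neg this, hfa]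
  · -- a fixed minimum cover together with one spare guard
    have hk1 : k = C₀.card + 1 := by
      have := mvc_insert_le (G := G) S x₀
      omega
    refine defendable_of_family m S k (fun C => ∃ z ∉ C₀, C = insert z C₀) ⟨_, x₀, ?_, rfl⟩ ?_ ?_
    · intro h
      have := mvc_le (S := insert x₀ S) hC₀ (Set.insert_subset (by exact_mod_cast h) hS₀)
      omega
    · rintro C ⟨z, hz, rfl⟩
      refine ⟨by rw [Finset.card_insert_of_notMem hz, hk1], hC₀.subset (by simp),
        hS₀.trans (by simp)⟩
    · rintro C ⟨z, hz, rfl⟩ a b hab ha hb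
      obtain ⟨f, w, hw, hfa, hfb, hfadj, hfC, -⟩ := exists_perm_shift_of_connected
        (C := ((insert z C₀ : Finset V) : Set V)) (T := {z})
        (hconn _ (hC₀.subset (by simp))) (by simp) ⟨z, rfl⟩
        (by exact_mod_cast ha) (by exact_mod_cast hb) hab
      obtain rfl : w = z := hw
      have hb₀ : b ∉ C₀ := fun h => hb (Finset.mem_insert_of_mem h)
      refine ⟨insert b C₀, ⟨b, hb₀, rfl⟩, f, f.injective.injOn, fun x hx => ?_,
        fun x hx => hfadj x (by exact_mod_cast hx), hfa⟩
      by_cases hxa : x = a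
      · subst hxa; simp [hfa]
      · have h1 : f x ∈ insert w C₀ := by exact_mod_cast hfC x (by exact_mod_cast hx) hxa
        rcases Finset.mem_insert.1 h1 with h | h
        · exact absurd (f.injective (h.trans hfb.symm) ▸ hx) hb
        · exact Finset.mem_insert_of_mem h

/-- If every vertex cover is connected and there are no isolated vertices, then `evc` is the
largest `mvc` that the prescription of one further vertex can cause. -/
theorem isGreatest_evc [Nonempty V] (m : GuardModel) (S : Set V)
    (hconn : ∀ C : Finset V, G.IsVertexCover (C : Set V) → (G.induce (C : Set V)).Connected)
    (hiso : ∀ x, ∃ y, G.Adj x y) :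
    IsGreatest (Set.range fun x => mvc G (insert x S)) (evc m G S) := by
  obtain ⟨x₀, hx₀⟩ := Finite.exists_max fun x => mvc G (insert x S)
  have hdef : Defendable m G S (mvc G (insert x₀ S)) :=
    defendable_of_forall_mvc_insert_le m hconn hx₀ ⟨x₀, rfl⟩
  have hub : ∀ x, mvc G (insert x S) ≤ evc m G S := by
    intro x
    obtain ⟨y, hxy⟩ := hiso x
    exact mvc_insert_le_of_defendable (Nat.sInf_mem (s := {k | Defendable m G S k}) ⟨_, hdef⟩) hxy
  refine ⟨⟨x₀, le_antisymm (hub x₀) (Nat.sInf_le hdef)⟩, ?_⟩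
  rintro _ ⟨x, rfl⟩
  exact hub x

end Evc

/-! ### Triangulated polygons -/

section Triangulated

variable {V : Type u}

/-- The vertex set `A` carries a triangulated polygon with the side `ab`: it is the edge `ab`, or
the triangle `abc` with triangulated polygons attached to its sides `ac` and `cb`.  (That the two
polygons share only `c` is not recorded here.) -/
inductive Triangulated (G : SimpleGraph V) : V → V → Set V → Prop
  | edge {a b : V} (h : G.Adj a b) : Triangulated G a b {a, b}
  | triangle {a b c : V} {A B : Set V} (h : G.Adj a b) (hA : Triangulated G a c A)
      (hB : Triangulated G c b B) : Triangulated G a b (A ∪ B)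

namespace Triangulated

variable {G : SimpleGraph V} {a b : V} {A : Set V}

lemma adj (h : Triangulated G a b A) : G.Adj a b := by cases h <;> assumption

lemma left_mem (h : Triangulated G a b A) : a ∈ A := by
  induction h with
  | edge h => simp
  | triangle h hA hB ihA ihB => exact Or.inl ihA

lemma right_mem (h : Triangulated G a b A) : b ∈ A := by
  induction h with
  | edge h => simp
  | triangle h hA hB ihA ihB => exact Or.inr ihB

lemma symm (h : Triangulated G a b A) : Triangulated G b a A := by
  induction h with
  | edge h => rw [Set.pair_comm]; exact .edge h.symm
  | triangle h hA hB ihA ihB => rw [Set.union_comm]; exact .triangle h.symm ihB ihA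

lemma exists_adj (h : Triangulated G a b A) {x : V} (hx : x ∈ A) : ∃ y ∈ A, G.Adj x y := by
  induction h with
  | @edge a b h =>
    rcases hx with rfl | rfl
    · exact ⟨b, by simp, h⟩
    · exact ⟨a, by simp, h.symm⟩
  | triangle h hA hB ihA ihB =>
    rcases hx with hx | hx
    · obtain ⟨y, hy, hxy⟩ := ihA hx
      exact ⟨y, Or.inl hy, hxy⟩
    · obtain ⟨y, hy, hxy⟩ := ihB hx
      exact ⟨y, Or.inr hy, hxy⟩

/-- A cover contains the apex `c` or both ends of the side `ab`, and either way the parts of the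
cover in the two attached polygons hang together. -/
lemma connected_cover (h : Triangulated G a b A) {C : Set V}
    (hC : ∀ x ∈ A, ∀ y ∈ A, G.Adj x y → x ∈ C ∨ y ∈ C) : (G.induce (C ∩ A)).Connected := by
  induction h with
  | @edge a b h =>
    by_cases ha : a ∈ C
    · by_cases hb : b ∈ C
      · rw [Set.inter_eq_right.2 (Set.pair_subset ha hb)]
        exact induce_pair_connected_of_adj h
      · have : C ∩ {a, b} = {a} := by
          ext x
          simp only [Set.mem_inter_iff, Set.mem_insert_iff, Set.mem_singleton_iff]
          constructor
          · rintro ⟨hx, rfl | rfl⟩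
            · rfl
            · exact absurd hx hb
          · rintro rfl; exact ⟨ha, Or.inl rfl⟩
        rw [this]
        simp
    · have hb := (hC a (by simp) b (by simp) h).resolve_left ha
      have : C ∩ {a, b} = {b} := by
        ext x
        simp only [Set.mem_inter_iff, Set.mem_insert_iff, Set.mem_singleton_iff]
        constructor
        · rintro ⟨hx, rfl | rfl⟩
          · exact absurd hx ha
          · rfl
        · rintro rfl; exact ⟨hb, Or.inr rfl⟩
      rw [this]
      simp
  | @triangle a b c A B h hA hB ihA ihB =>
    have h1 := ihA fun x hx y hy => hC x (Or.inl hx) y (Or.inl hy)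
    have h2 := ihB fun x hx y hy => hC x (Or.inr hx) y (Or.inr hy)
    rw [Set.inter_union_distrib_left]
    by_cases hc : c ∈ C
    · exact induce_union_connected h1.preconnected h2.preconnected
        ⟨c, ⟨hc, hA.right_mem⟩, hc, hB.left_mem⟩
    · have ha := (hC a (Or.inl hA.left_mem) c (Or.inl hA.right_mem) hA.adj).resolve_right hc
      have hb := (hC c (Or.inr hB.left_mem) b (Or.inr hB.right_mem) hB.adj).resolve_left hc
      exact connected_induce_union h1.preconnected h2.preconnected ⟨ha, hA.left_mem⟩
        ⟨hb, hB.right_mem⟩ h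

lemma connected (h : Triangulated G a b A) : (G.induce A).Connected := by
  have := h.connected_cover (C := Set.univ) (by simp)
  rwa [Set.univ_inter] at this

/-- A triangulated polygon has no cut vertex. -/
lemma connected_diff (h : Triangulated G a b A) (x : V) : (G.induce (A \ {x})).Connected := by
  induction h with
  | @edge a b h =>
    by_cases hx : x = a ∨ x = b
    · have : ∃ y, ({a, b} : Set V) \ {x} = {y} := by
        rcases hx with rfl | rfl
        · exact ⟨b, by rw [Set.insert_sdiff_self_of_notMem (by simpa using h.ne)]⟩
        · exact ⟨a, by rw [Set.pair_comm, Set.insert_sdiff_self_of_notMem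
            (by simpa using h.ne.symm)]⟩
      obtain ⟨y, hy⟩ := this
      rw [hy]
      simp
    · rw [Set.sdiff_singleton_eq_self (by simpa using hx)]
      exact induce_pair_connected_of_adj h
  | @triangle a b c A B h hA hB ihA ihB =>
    rw [Set.union_sdiff_distrib]
    by_cases hc : x = c
    · subst hc
      exact connected_induce_union ihA.preconnected ihB.preconnected
        ⟨hA.left_mem, hA.adj.ne⟩ ⟨hB.right_mem, hB.adj.ne'⟩ h
    · exact induce_union_connected ihA.preconnected ihB.preconnected
        ⟨c, ⟨hA.right_mem, fun h => hc h.symm⟩, hB.left_mem, fun h => hc h.symm⟩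

end Triangulated

/-- The graph `G` is the triangle `uvw` with triangulated polygons on `A` and `B` attached to its
sides `uw` and `vw`, and nothing attached to `uv`. -/
structure SplitsAt (G : SimpleGraph V) (u v w : V) (A B : Set V) : Prop where
  left : Triangulated G u w A
  right : Triangulated G v w B
  adj : G.Adj u v
  union_eq : A ∪ B = Set.univ
  inter_eq : A ∩ B = {w}
  cross : ∀ x ∈ A, ∀ y ∈ B, G.Adj x y → x = w ∨ y = w ∨ (x = u ∧ y = v)

namespace SplitsAt

variable {G : SimpleGraph V} {u v w : V} {A B : Set V}

lemma symm (h : SplitsAt G u v w A B) : SplitsAt G v u w B A where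
  left := h.right
  right := h.left
  adj := h.adj.symm
  union_eq := by rw [Set.union_comm]; exact h.union_eq
  inter_eq := by rw [Set.inter_comm]; exact h.inter_eq
  cross x hx y hy hxy := by
    rcases h.cross y hy x hx hxy.symm with h | h | h
    · exact Or.inr (Or.inl h)
    · exact Or.inl h
    · exact Or.inr (Or.inr h.symm)

lemma eq_apex (h : SplitsAt G u v w A B) {x : V} (hA : x ∈ A) (hB : x ∈ B) : x = w := by
  have : x ∈ A ∩ B := ⟨hA, hB⟩
  rwa [h.inter_eq] at this

lemma mem_or_mem (h : SplitsAt G u v w A B) (x : V) : x ∈ A ∨ x ∈ B := by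
  have : x ∈ A ∪ B := h.union_eq ▸ Set.mem_univ x
  exact this

lemma right_notMem (h : SplitsAt G u v w A B) : v ∉ A := fun hv =>
  h.right.adj.ne (h.eq_apex hv h.right.left_mem)

lemma triangulated (h : SplitsAt G u v w A B) : Triangulated G u v Set.univ :=
  h.union_eq ▸ .triangle h.adj h.left h.right.symm

lemma common_neighbour_iff (h : SplitsAt G u v w A B) (x : V) :
    (G.Adj u x ∧ G.Adj v x) ↔ x = w := by
  constructor
  · rintro ⟨hu, hv⟩
    rcases h.mem_or_mem x with hx | hx
    · rcases h.cross x hx v h.right.left_mem hv.symm with h1 | h1 | h1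
      · exact h1
      · exact absurd h1 h.right.adj.ne
      · exact absurd h1.1 hu.ne'
    · rcases h.cross u h.left.left_mem x hx hu with h1 | h1 | h1
      · exact absurd h1 h.left.adj.ne
      · exact h1
      · exact absurd h1.2 hv.ne'
  · rintro rfl
    exact ⟨h.left.adj, h.right.adj⟩

lemma isBiconnected (h : SplitsAt G u v w A B) :
    IsBiconnected ((⊤ : G.Subgraph).induce A) := by
  refine ⟨connected_induce_iff.1 h.left.connected, fun x _ => ?_⟩
  have : ((⊤ : G.Subgraph).induce A).deleteVerts {x} = (⊤ : G.Subgraph).induce (A \ {x}) := by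
    ext y z
    · simp
    · simp only [Subgraph.induce_adj, Subgraph.top_adj,
        Subgraph.induce_verts, Set.mem_sdiff, Set.mem_singleton_iff]
      tauto
  rw [this]
  exact preconnected_induce_iff.1 (h.left.connected_diff x).preconnected

/-- The side `uw` is visible from the point of the circle at `v`: by the edges `vu` and `vw`, any
edge that separates `v` from the rest of the circle at all leaves `u` and `w` on the far side. -/
lemma isOuterEdge (h : SplitsAt G u v w A B) (φ : OuterplanarEmbedding G) :
    φ.IsOuterEdge ((⊤ : G.Subgraph).induce A) u w := by
  refine ⟨by simpa using ⟨h.left.left_mem, h.left.right_mem, h.left.adj⟩, φ.pos v,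
    fun c d hcd hlt hne => ?_⟩
  simp only [Subgraph.induce_adj, Subgraph.top_adj] at hcd
  obtain ⟨hc, hd, hcd⟩ := hcd
  have hcv : φ.pos c ≠ φ.pos v := fun e => h.right_notMem (φ.pos_injective e ▸ hc)
  have hdv : φ.pos d ≠ φ.pos v := fun e => h.right_notMem (φ.pos_injective e ▸ hd)
  have huw : φ.pos u ≠ φ.pos w := fun e => h.left.adj.ne (φ.pos_injective e)
  have hne1 : ¬ (φ.pos c = φ.pos u ∧ φ.pos d = φ.pos w) := by
    rintro ⟨e1, e2⟩
    exact hne (by rw [φ.pos_injective e1, φ.pos_injective e2])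
  have hne2 : ¬ (φ.pos c = φ.pos w ∧ φ.pos d = φ.pos u) := by
    rintro ⟨e1, e2⟩
    exact hne (by rw [φ.pos_injective e1, φ.pos_injective e2, Sym2.eq_swap])
  simp only [Set.mem_Icc]
  constructor
  · have n1 := φ.noncrossing c d v u hcd h.adj.symm
    have n2 := φ.noncrossing u v c d h.adj hcd
    have n3 := φ.noncrossing c d v w hcd h.right.adj
    have n4 := φ.noncrossing w v c d h.right.adj.symm hcd
    omega
  · rintro ⟨hu, hw⟩
    by_contra hv
    rcases (show φ.pos v < φ.pos c ∨ φ.pos d < φ.pos v by omega) with hv | hv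
    · have n1 := φ.noncrossing v u c d h.adj.symm hcd
      have n2 := φ.noncrossing v w c d h.right.adj hcd
      omega
    · have n1 := φ.noncrossing c d u v hcd h.adj
      have n2 := φ.noncrossing c d w v hcd h.right.adj.symm
      omega

/-- A biconnected subgraph through `u` and `w` that avoids `v` stays inside `A`: after removing
`w`, no walk inside it leads from `B` to `u`, as `uv` is the only other way out of `B`. -/
lemma le_induce (h : SplitsAt G u v w A B) {K : G.Subgraph} (hK : IsBiconnected K)
    (hu : u ∈ K.verts) (hw : w ∈ K.verts) (hv : v ∉ K.verts) :
    K ≤ (⊤ : G.Subgraph).induce A := by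
  have hsub : K.verts ⊆ A := by
    intro x hx
    by_contra hxA
    have hxB := (h.mem_or_mem x).resolve_left hxA
    have hxw : x ≠ w := by rintro rfl; exact hxA h.left.right_mem
    have hpre := (hK.2 w hw).coe
    obtain ⟨p⟩ := hpre ⟨x, hx, hxw⟩ ⟨u, hu, h.left.adj.ne⟩
    have key : ∀ y z : (K.deleteVerts {w}).verts, (K.deleteVerts {w}).coe.Walk y z →
        (y : V) ∉ A → (z : V) ∉ A := by
      intro y z p
      induction p with
      | nil => exact id
      | @cons y z _ hyz _ ih =>
        intro hy
        refine ih fun hz => ?_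
        have hyB := (h.mem_or_mem (y : V)).resolve_left hy
        have hadj : G.Adj (z : V) (y : V) := (Subgraph.coe_adj_sub _ _ _ hyz).symm
        rcases h.cross z hz y hyB hadj with e | e | e
        · exact z.2.2 e
        · exact y.2.2 e
        · exact hv (e.2 ▸ y.2.1)
    exact key _ _ p hxA h.left.left_mem
  refine ⟨hsub, fun x y hxy => ?_⟩
  simp only [Subgraph.induce_adj, Subgraph.top_adj]
  exact ⟨hsub (K.edge_vert hxy), hsub (K.edge_vert hxy.symm), hxy.adj_sub⟩

lemma isSegment (h : SplitsAt G u v w A B) (φ : OuterplanarEmbedding G) :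
    φ.IsSegment u v w ((⊤ : G.Subgraph).induce A) := by
  refine ⟨⟨h.isBiconnected, h.isOuterEdge φ, h.right_notMem⟩, ?_⟩
  rintro K ⟨h1, ⟨h2, -⟩, h3⟩
  exact h.le_induce h1 (K.edge_vert h2) (K.edge_vert h2.symm) h3

end SplitsAt

end Triangulated

/-! ### Maximal outerplanar graphs are triangulated polygons -/

section Embedding

variable {V : Type u} {G : SimpleGraph V}

/-- The circle can be cut open at a point from which the outer edge `ab` is visible, so that no
other edge encloses `ab`. -/
lemma OuterplanarEmbedding.IsOuterEdge.exists_rotation [Finite V] {φ : OuterplanarEmbedding G}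
    {a b : V} (h : φ.IsOuterEdge ⊤ a b) :
    ∃ ψ : OuterplanarEmbedding G, ∀ c d, G.Adj c d → ψ.pos c < ψ.pos d → s(c, d) ≠ s(a, b) →
      ¬ (ψ.pos a ∈ Set.Icc (ψ.pos c) (ψ.pos d) ∧ ψ.pos b ∈ Set.Icc (ψ.pos c) (ψ.pos d)) := by
  obtain ⟨hab, t, ht⟩ := h
  have hab' : φ.pos a ≠ φ.pos b := fun e => hab.ne (φ.pos_injective e)
  obtain ⟨N, hN⟩ : ∃ N, ∀ x, φ.pos x < N := by
    obtain ⟨x, hx⟩ := @Finite.exists_max V ℕ _ ⟨a⟩ _ φ.pos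
    exact ⟨φ.pos x + 1, fun y => Nat.lt_succ_of_le (hx y)⟩
  -- the vertices before the cut are moved behind all others
  let q : V → ℕ := fun x => if φ.pos x < t then φ.pos x + N else φ.pos x
  have hq : ∀ x, (φ.pos x < t ∧ q x = φ.pos x + N) ∨ (t ≤ φ.pos x ∧ q x = φ.pos x) := by
    intro x
    by_cases h : φ.pos x < t
    · exact Or.inl ⟨h, if_pos h⟩
    · exact Or.inr ⟨not_lt.1 h, if_neg h⟩
  refine ⟨⟨q, fun x y hxy => φ.pos_injective ?_, fun a b c d hab hcd => ?_⟩, ?_⟩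
  · have := hq x; have := hq y; have := hN x; have := hN y
    omega
  · have := hq a; have := hq b; have := hq c; have := hq d
    have := hN a; have := hN b; have := hN c; have := hN d
    have n1 := φ.noncrossing a b c d hab hcd
    have n2 := φ.noncrossing c d b a hcd hab.symm
    have n3 := φ.noncrossing b a d c hab.symm hcd.symm
    have n4 := φ.noncrossing d c a b hcd.symm hab
    omega
  · intro c d hcd hlt hne
    change q c < q d at hlt
    change ¬ ((q c ≤ q a ∧ q a ≤ q d) ∧ (q c ≤ q b ∧ q b ≤ q d))
    have h1 := ht c d hcd
    have h2 := ht d c hcd.symm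
    rw [Sym2.eq_swap] at h2
    simp only [Set.mem_Icc] at h1 h2
    have hne1 : ¬ (φ.pos c = φ.pos a ∧ φ.pos d = φ.pos b) := by
      rintro ⟨e1, e2⟩
      exact hne (by rw [φ.pos_injective e1, φ.pos_injective e2])
    have hne2 : ¬ (φ.pos c = φ.pos b ∧ φ.pos d = φ.pos a) := by
      rintro ⟨e1, e2⟩
      exact hne (by rw [φ.pos_injective e1, φ.pos_injective e2, Sym2.eq_swap])
    have h1 := fun h => h1 h hne
    have h2 := fun h => h2 h hne
    have := hq a; have := hq b; have := hq c; have := hq d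
    have := hN a; have := hN b; have := hN c; have := hN d
    rcases lt_trichotomy (φ.pos c) (φ.pos d) with hl | hl | hl
    · have h1 := h1 hl
      omega
    · omega
    · have h2 := h2 hl
      omega

/-- By maximality, vertices are adjacent if their chord crosses no edge. -/
lemma IsMaximalOuterplanar.adj_of_not_cross (hG : IsMaximalOuterplanar G)
    (ψ : OuterplanarEmbedding G) {a b : V} (hab : ψ.pos a < ψ.pos b)
    (h : ∀ x y, G.Adj x y → ψ.pos a < ψ.pos x → ψ.pos x < ψ.pos b →
      ψ.pos a ≤ ψ.pos y ∧ ψ.pos y ≤ ψ.pos b) : G.Adj a b := by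
  by_contra hnadj
  have hne : a ≠ b := by rintro rfl; exact lt_irrefl _ hab
  refine hG.2 (G ⊔ SimpleGraph.edge a b) ?_ ⟨⟨ψ.pos, ψ.pos_injective, fun c d e f hcd hef => ?_⟩⟩
  · refine lt_of_le_of_ne le_sup_left fun heq => hnadj ?_
    rw [heq]
    exact Or.inr (by simp [SimpleGraph.edge_adj, hne])
  · rintro ⟨h1, h2, h3⟩
    rw [SimpleGraph.sup_adj, SimpleGraph.edge_adj] at hcd hef
    rcases hcd with hcd | ⟨⟨rfl, rfl⟩ | ⟨rfl, rfl⟩, -⟩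
    · rcases hef with hef | ⟨⟨rfl, rfl⟩ | ⟨rfl, rfl⟩, -⟩
      · exact ψ.noncrossing c d e f hcd hef ⟨h1, h2, h3⟩
      · have := h d c hcd.symm h2 h3
        omega
      · omega
    · rcases hef with hef | ⟨⟨rfl, rfl⟩ | ⟨rfl, rfl⟩, -⟩
      · have := h e f hef h1 h2
        omega
      · omega
      · omega
    · omega

/-- An edge with vertices between its ends is the side of a triangle with its apex among them:
take the neighbour of `a` that is nearest to `b`. -/
lemma IsMaximalOuterplanar.exists_apex [Finite V] (hG : IsMaximalOuterplanar G)
    (ψ : OuterplanarEmbedding G) {a b x : V} (hab : G.Adj a b) (hax : ψ.pos a < ψ.pos x)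
    (hxb : ψ.pos x < ψ.pos b) :
    ∃ c, ψ.pos a < ψ.pos c ∧ ψ.pos c < ψ.pos b ∧ G.Adj a c ∧ G.Adj c b := by
  obtain ⟨s, ⟨hs1, hs2⟩, hs⟩ := Set.exists_min_image {y | ψ.pos a < ψ.pos y ∧ ψ.pos y < ψ.pos b}
    ψ.pos (Set.toFinite _) ⟨x, hax, hxb⟩
  have has : G.Adj a s := hG.adj_of_not_cross ψ hs1 fun y z _ h1 h2 =>
    absurd (hs y ⟨h1, h2.trans hs2⟩) (not_le.2 h2)
  obtain ⟨c, ⟨hc1, hc2, hac⟩, hc⟩ := Set.exists_max_image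
    {y | ψ.pos a < ψ.pos y ∧ ψ.pos y < ψ.pos b ∧ G.Adj a y} ψ.pos (Set.toFinite _)
    ⟨s, hs1, hs2, has⟩
  refine ⟨c, hc1, hc2, hac, hG.adj_of_not_cross ψ hc2 fun y z hyz h1 h2 => ?_⟩
  have n1 := ψ.noncrossing a b y z hab hyz
  have n2 := ψ.noncrossing z y a b hyz.symm hab
  have n3 := ψ.noncrossing a c z y hac hyz.symm
  have hza : ψ.pos z ≠ ψ.pos a := fun e => by
    have := hc y ⟨by omega, h2, ψ.pos_injective e ▸ hyz.symm⟩
    omega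
  omega

lemma IsMaximalOuterplanar.triangulated [Finite V] (hG : IsMaximalOuterplanar G)
    (ψ : OuterplanarEmbedding G) {a b : V} (hab : G.Adj a b) (hlt : ψ.pos a < ψ.pos b) :
    Triangulated G a b {x | ψ.pos a ≤ ψ.pos x ∧ ψ.pos x ≤ ψ.pos b} := by
  induction hn : ψ.pos b - ψ.pos a using Nat.strong_induction_on generalizing a b with
  | _ n ih =>
    by_cases hx : ∃ x, ψ.pos a < ψ.pos x ∧ ψ.pos x < ψ.pos b
    · obtain ⟨x, h1, h2⟩ := hx
      obtain ⟨c, hc1, hc2, hac, hcb⟩ := hG.exists_apex ψ hab h1 h2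
      have := Triangulated.triangle hab (ih _ (by omega) hac hc1 rfl) (ih _ (by omega) hcb hc2 rfl)
      convert this using 1
      ext y
      simp only [Set.mem_ofPred_eq, Set.mem_union]
      omega
    · convert Triangulated.edge hab using 1
      ext y
      simp only [Set.mem_ofPred_eq, Set.mem_insert_iff, Set.mem_singleton_iff]
      constructor
      · rintro ⟨h1, h2⟩
        by_contra! hne
        have e1 : ψ.pos y ≠ ψ.pos a := fun e => hne.1 (ψ.pos_injective e)
        have e2 : ψ.pos y ≠ ψ.pos b := fun e => hne.2 (ψ.pos_injective e)
        exact hx ⟨y, by omega, by omega⟩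
      · rintro (rfl | rfl) <;> omega

/-- If the circle is listed from `a` to `b`, the apex of the triangle at `ab` splits the graph. -/
lemma IsMaximalOuterplanar.splitsAt [Finite V] (hG : IsMaximalOuterplanar G)
    (ψ : OuterplanarEmbedding G) {a b x : V} (hab : G.Adj a b)
    (hfirst : ∀ y, ψ.pos a ≤ ψ.pos y) (hlast : ∀ y, ψ.pos y ≤ ψ.pos b) (hxa : x ≠ a)
    (hxb : x ≠ b) : ∃ w A B, SplitsAt G a b w A B := by
  have e1 : ψ.pos x ≠ ψ.pos a := fun e => hxa (ψ.pos_injective e)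
  have e2 : ψ.pos x ≠ ψ.pos b := fun e => hxb (ψ.pos_injective e)
  have l1 := hfirst x
  have l2 := hlast x
  obtain ⟨w, hw1, hw2, haw, hwb⟩ := hG.exists_apex ψ hab (x := x) (by omega) (by omega)
  refine ⟨w, _, _, hG.triangulated ψ haw hw1, (hG.triangulated ψ hwb hw2).symm, hab, ?_, ?_, ?_⟩
  · ext y
    have := hfirst y
    have := hlast y
    simp only [Set.mem_union, Set.mem_ofPred_eq, Set.mem_univ, iff_true]
    omega
  · ext y
    simp only [Set.mem_inter_iff, Set.mem_ofPred_eq, Set.mem_singleton_iff]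
    constructor
    · rintro ⟨h1, h2⟩
      exact ψ.pos_injective (by omega)
    · rintro rfl; omega
  · rintro y ⟨hy1, hy2⟩ z ⟨hz1, hz2⟩ hyz
    by_contra! hne
    have e3 : ψ.pos y ≠ ψ.pos w := fun e => hne.1 (ψ.pos_injective e)
    have e4 : ψ.pos z ≠ ψ.pos w := fun e => hne.2.1 (ψ.pos_injective e)
    have n1 := ψ.noncrossing a w y z haw hyz
    have n2 := ψ.noncrossing y z w b hyz hwb
    have e5 : ψ.pos y = ψ.pos a := by omega
    have e6 : ψ.pos z = ψ.pos b := by omega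
    exact hne.2.2 (ψ.pos_injective e5) (ψ.pos_injective e6)

/-- The outer edge `uv` joins the first and the last vertex of the circle cut open in sight of
`uv`, since these are adjacent by maximality and their chord encloses everything. -/
lemma IsMaximalOuterplanar.exists_splitsAt [Finite V] (hG : IsMaximalOuterplanar G)
    {φ : OuterplanarEmbedding G} {u v x : V} (huv : φ.IsOuterEdge ⊤ u v) (hxu : x ≠ u)
    (hxv : x ≠ v) : ∃ w A B, SplitsAt G u v w A B := by
  obtain ⟨ψ, hψ⟩ := huv.exists_rotation
  have hadj : G.Adj u v := huv.1
  obtain ⟨p, hp⟩ := @Finite.exists_min V ℕ _ ⟨u⟩ _ ψ.pos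
  obtain ⟨q, hq⟩ := @Finite.exists_max V ℕ _ ⟨u⟩ _ ψ.pos
  have huv' : ψ.pos u ≠ ψ.pos v := fun e => hadj.ne (ψ.pos_injective e)
  have hlt : ψ.pos p < ψ.pos q := by
    have := hp u; have := hp v; have := hq u; have := hq v
    omega
  have hpq : G.Adj p q := hG.adj_of_not_cross ψ hlt fun y z _ _ _ => ⟨hp z, hq z⟩
  have : s(p, q) = s(u, v) := by
    by_contra hne
    exact hψ p q hpq hlt hne ⟨⟨hp u, hq u⟩, hp v, hq v⟩
  rcases Sym2.eq_iff.1 this with ⟨rfl, rfl⟩ | ⟨rfl, rfl⟩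
  · exact hG.splitsAt ψ hadj hp hq hxu hxv
  · obtain ⟨w, A, B, h⟩ := hG.splitsAt ψ hadj.symm hp hq hxv hxu
    exact ⟨w, B, A, h.symm⟩

end Embedding

/-! ### Covers of a graph composed of two segments -/

/-- The values of `f` with respect to `a` and `b`, where all vertices of `S` are prescribed. -/
def paramsOf {V : Type u} (f : Set V → ℕ) (a b : V) (S : Set V) : EdgeParams :=
  ⟨f S, f (insert a S), f (insert b S), f (insert a (insert b S))⟩

/-- The least size of a vertex cover of the subgraph induced on `A` that contains `S ∩ A`. -/
noncomputable def mvcOn {V : Type u} (G : SimpleGraph V) (A S : Set V) : ℕ :=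
  mvc ((⊤ : G.Subgraph).induce A).coe (Subtype.val ⁻¹' S)

/-- The mvc parameters of the triangle `uvw` with two segments attached to its sides `uw` and
`vw`, in terms of the parameters `t` and `s` of the segments: a cover contains two of `u`, `v`,
`w`, and the segments share `w`.  Where prescribing `u` or `v` turns two of the three options into
comparable ones, the dearer one is omitted. -/
def glue (t s : EdgeParams) : EdgeParams where
  free := min (t.both + s.snd - 1) (min (t.snd + s.both - 1) (t.fst + s.fst))
  fst := min (t.both + s.snd - 1) (t.fst + s.fst)
  snd := min (t.snd + s.both - 1) (t.fst + s.fst)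
  both := min (t.both + s.both - 1) (t.fst + s.fst)

lemma preimage_val_insert {V : Type u} {A : Set V} {x : V} (hx : x ∈ A) (S : Set V) :
    (Subtype.val ⁻¹' (insert x S) : Set A) = insert ⟨x, hx⟩ (Subtype.val ⁻¹' S) := by
  ext y
  simp [Subtype.ext_iff]

section Glue

variable {V : Type u} {G : SimpleGraph V} {u v w : V} {A B S T : Set V}

lemma mvcOn_le {C : Finset V} (hC : ∀ x ∈ A, ∀ y ∈ A, G.Adj x y → x ∈ C ∨ y ∈ C)
    (hCA : (C : Set V) ⊆ A) (hS : S ∩ A ⊆ C) : mvcOn G A S ≤ C.card := by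
  classical
  let D : Finset ((⊤ : G.Subgraph).induce A).verts :=
    C.subtype (· ∈ ((⊤ : G.Subgraph).induce A).verts)
  have hD : D.card = C.card := by
    exact (Finset.card_subtype _ _).trans
      (congrArg _ (Finset.filter_true_of_mem fun x hx => hCA hx))
  rw [← hD]
  refine mvc_le (fun x y hxy => ?_) fun x hx => ?_
  · rw [Subgraph.coe_adj, Subgraph.induce_adj] at hxy
    exact (hC x hxy.1 y hxy.2.1 hxy.2.2).imp Finset.mem_subtype.2 Finset.mem_subtype.2
  · have : (x : V) ∈ (C : Set V) := hS ⟨hx, x.2⟩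
    exact Finset.mem_subtype.2 this

variable [Finite V]

lemma exists_card_eq_mvcOn (G : SimpleGraph V) (A S : Set V) :
    ∃ C : Finset V, C.card = mvcOn G A S ∧ (C : Set V) ⊆ A ∧
      (∀ x ∈ A, ∀ y ∈ A, G.Adj x y → x ∈ C ∨ y ∈ C) ∧ S ∩ A ⊆ C := by
  obtain ⟨D, hc, hD, hS⟩ := exists_card_eq_mvc ((⊤ : G.Subgraph).induce A).coe
    (Subtype.val ⁻¹' S)
  refine ⟨D.map (Function.Embedding.subtype _), by rw [Finset.card_map]; exact hc, ?_, ?_, ?_⟩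
  · intro x hx
    obtain ⟨y, -, rfl⟩ := Finset.mem_map.1 (Finset.mem_coe.1 hx)
    exact y.2
  · intro x hx y hy hxy
    have hadj : ((⊤ : G.Subgraph).induce A).coe.Adj ⟨x, hx⟩ ⟨y, hy⟩ := ⟨hx, hy, hxy⟩
    rcases hD hadj with h | h
    · exact Or.inl (Finset.mem_map.2 ⟨_, Finset.mem_coe.1 h, rfl⟩)
    · exact Or.inr (Finset.mem_map.2 ⟨_, Finset.mem_coe.1 h, rfl⟩)
  · rintro x ⟨hxS, hxA⟩
    have : (⟨x, hxA⟩ : ((⊤ : G.Subgraph).induce A).verts) ∈ (D : Set _) := hS hxS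
    exact Finset.mem_coe.2 (Finset.mem_map.2 ⟨_, Finset.mem_coe.1 this, rfl⟩)

namespace SplitsAt

/-- The union of covers of the two segments covers the whole graph, if one of them covers `uv`. -/
lemma exists_cover_union [DecidableEq V] (h : SplitsAt G u v w A B) {S T : Set V}
    (huv : u ∈ S ∨ v ∈ T) :
    ∃ C D : Finset V, C.card = mvcOn G A S ∧ D.card = mvcOn G B T ∧
      G.IsVertexCover ((C ∪ D : Finset V) : Set V) ∧ S ∩ A ⊆ C ∧ T ∩ B ⊆ D := by
  obtain ⟨C, hc, -, hC, hCS⟩ := exists_card_eq_mvcOn G A S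
  obtain ⟨D, hd, -, hD, hDT⟩ := exists_card_eq_mvcOn G B T
  have huv' : u ∈ C ∨ v ∈ D :=
    huv.imp (fun hu => hCS ⟨hu, h.left.left_mem⟩) fun hv => hDT ⟨hv, h.right.left_mem⟩
  have key : ∀ x ∈ A, ∀ y ∈ B, G.Adj x y → x ∈ C ∪ D ∨ y ∈ C ∪ D := by
    intro x hx y hy hxy
    simp only [Finset.mem_union]
    rcases h.cross x hx y hy hxy with rfl | rfl | ⟨rfl, rfl⟩
    · have := hD x h.right.right_mem y hy hxy
      tauto
    · have := hC x hx y h.left.right_mem hxy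
      tauto
    · tauto
  refine ⟨C, D, hc, hd, fun x y hxy => ?_, hCS, hDT⟩
  rw [Finset.mem_coe, Finset.mem_coe]
  rcases h.mem_or_mem x with hx | hx <;> rcases h.mem_or_mem y with hy | hy
  · exact (hC x hx y hy hxy).imp (Finset.mem_union_left D) (Finset.mem_union_left D)
  · exact key x hx y hy hxy
  · exact (key y hy x hx hxy.symm).symm
  · exact (hD x hx y hy hxy).imp (Finset.mem_union_right C) (Finset.mem_union_right C)

lemma mvc_le_add (h : SplitsAt G u v w A B) {S T R : Set V}
    (hR : ∀ x ∈ R, x ∈ S ∩ A ∨ x ∈ T ∩ B) (huv : u ∈ S ∨ v ∈ T) :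
    mvc G R ≤ mvcOn G A S + mvcOn G B T := by
  classical
  obtain ⟨C, D, hc, hd, hcov, hS, hT⟩ := h.exists_cover_union huv
  refine (mvc_le hcov fun x hx => ?_).trans ((Finset.card_union_le C D).trans (by rw [hc, hd]))
  rw [Finset.coe_union]
  exact (hR x hx).imp (fun h => hS h) fun h => hT h

lemma mvc_add_one_le_add (h : SplitsAt G u v w A B) {S T R : Set V}
    (hR : ∀ x ∈ R, x ∈ S ∩ A ∨ x ∈ T ∩ B) (huv : u ∈ S ∨ v ∈ T) (hwS : w ∈ S) (hwT : w ∈ T) :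
    mvc G R + 1 ≤ mvcOn G A S + mvcOn G B T := by
  classical
  obtain ⟨C, D, hc, hd, hcov, hS, hT⟩ := h.exists_cover_union huv
  have hw : w ∈ C ∩ D :=
    Finset.mem_inter.2 ⟨hS ⟨hwS, h.left.right_mem⟩, hT ⟨hwT, h.right.right_mem⟩⟩
  have := mvc_le (S := R) hcov fun x hx => by
    rw [Finset.coe_union]
    exact (hR x hx).imp (fun h => hS h) fun h => hT h
  have h1 := Finset.card_union_add_card_inter C D
  have h2 := Finset.card_pos.2 ⟨w, hw⟩
  omega

/-- A cover of the whole graph contains `u` and `w`, or `v` and `w`, or `u` and `v`; it is the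
union of covers of the segments, which share at most `w`. -/
lemma mvc_union (h : SplitsAt G u v w A B) (hS : S ⊆ A) (hT : T ⊆ B) :
    (mvc G (S ∪ T) : ℤ) =
      min (mvcOn G A (insert u (insert w S)) + mvcOn G B (insert w T) - 1 : ℤ)
        (min (mvcOn G A (insert w S) + mvcOn G B (insert v (insert w T)) - 1)
          (mvcOn G A (insert u S) + mvcOn G B (insert v T))) := by
  classical
  apply le_antisymm
  · have h1 := h.mvc_add_one_le_add (S := insert u (insert w S)) (T := insert w T) (R := S ∪ T)
      (fun x hx => hx.imp (fun h => ⟨by simp [h], hS h⟩) fun h => ⟨by simp [h], hT h⟩)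
      (by simp) (by simp) (by simp)
    have h2 := h.mvc_add_one_le_add (S := insert w S) (T := insert v (insert w T)) (R := S ∪ T)
      (fun x hx => hx.imp (fun h => ⟨by simp [h], hS h⟩) fun h => ⟨by simp [h], hT h⟩)
      (by simp) (by simp) (by simp)
    have h3 := h.mvc_le_add (S := insert u S) (T := insert v T) (R := S ∪ T)
      (fun x hx => hx.imp (fun h => ⟨by simp [h], hS h⟩) fun h => ⟨by simp [h], hT h⟩)
      (by simp)
    omega
  · obtain ⟨C, hc, hC, hST⟩ := exists_card_eq_mvc G (S ∪ T)
    have hA : ∀ R : Set V, (∀ x ∈ R, x ∈ C) → mvcOn G A R ≤ (C.filter (· ∈ A)).card :=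
      fun R hR => mvcOn_le (fun x hx y hy hxy => by simpa [hx, hy] using hC hxy)
        (fun x hx => (Finset.mem_filter.1 hx).2)
        fun x hx => by simpa [hx.2] using hR x hx.1
    have hB : ∀ R : Set V, (∀ x ∈ R, x ∈ C) → mvcOn G B R ≤ (C.filter (· ∈ B)).card :=
      fun R hR => mvcOn_le (fun x hx y hy hxy => by simpa [hx, hy] using hC hxy)
        (fun x hx => (Finset.mem_filter.1 hx).2)
        fun x hx => by simpa [hx.2] using hR x hx.1
    have hSC : ∀ x ∈ S, x ∈ C := fun x hx => hST (Or.inl hx)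
    have hTC : ∀ x ∈ T, x ∈ C := fun x hx => hST (Or.inr hx)
    have hunion : C.filter (· ∈ A) ∪ C.filter (· ∈ B) = C := by
      ext x
      have := h.mem_or_mem x
      simp only [Finset.mem_union, Finset.mem_filter]
      tauto
    have hcard := Finset.card_union_add_card_inter (C.filter (· ∈ A)) (C.filter (· ∈ B))
    rw [hunion, hc] at hcard
    by_cases hw : w ∈ C
    · have hinter : C.filter (· ∈ A) ∩ C.filter (· ∈ B) = {w} := by
        ext x
        simp only [Finset.mem_inter, Finset.mem_filter, Finset.mem_singleton]
        constructor
        · rintro ⟨⟨-, h1⟩, -, h2⟩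
          exact h.eq_apex h1 h2
        · rintro rfl
          exact ⟨⟨hw, h.left.right_mem⟩, hw, h.right.right_mem⟩
      rw [hinter, Finset.card_singleton] at hcard
      rcases hC h.adj with hu | hv
      · have hu : u ∈ C := hu
        have h1 := hA (insert u (insert w S)) (by
          rintro x (rfl | rfl | hx)
          exacts [hu, hw, hSC x hx])
        have h2 := hB (insert w T) (by
          rintro x (rfl | hx)
          exacts [hw, hTC x hx])
        omega
      · have hv : v ∈ C := hv
        have h1 := hA (insert w S) (by
          rintro x (rfl | hx)
          exacts [hw, hSC x hx])
        have h2 := hB (insert v (insert w T)) (by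
          rintro x (rfl | rfl | hx)
          exacts [hv, hw, hTC x hx])
        omega
    · have hu : u ∈ C := (hC h.left.adj).resolve_right hw
      have hv : v ∈ C := (hC h.right.adj).resolve_right hw
      have hinter : C.filter (· ∈ A) ∩ C.filter (· ∈ B) = ∅ := by
        ext x
        simp only [Finset.mem_inter, Finset.mem_filter, Finset.notMem_empty, iff_false]
        rintro ⟨⟨h0, h1⟩, -, h2⟩
        exact hw (h.eq_apex h1 h2 ▸ h0)
      rw [hinter, Finset.card_empty] at hcard
      have h1 := hA (insert u S) (by
        rintro x (rfl | hx)
        exacts [hu, hSC x hx])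
      have h2 := hB (insert v T) (by
        rintro x (rfl | hx)
        exacts [hv, hTC x hx])
      omega

end SplitsAt

lemma mvcOn_mono (h : S ⊆ T) : mvcOn G A S ≤ mvcOn G A T :=
  mvc_mono (Set.preimage_mono h)

/-- The mvc parameters of the composed graph, with a set of further prescribed vertices. -/
lemma SplitsAt.paramsOf_mvc (h : SplitsAt G u v w A B) (hS : S ⊆ A) (hT : T ⊆ B) :
    paramsOf (mvc G) u v (S ∪ T) =
      glue (paramsOf (mvcOn G A) u w S) (paramsOf (mvcOn G B) v w T) := by
  have hu := h.left.left_mem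
  have hv := h.right.left_mem
  have h1 := h.mvc_union hS hT
  have h2 := h.mvc_union (Set.insert_subset hu hS) hT
  have h3 := h.mvc_union hS (Set.insert_subset hv hT)
  have h4 := h.mvc_union (Set.insert_subset hu hS) (Set.insert_subset hv hT)
  rw [Set.insert_comm w u, Set.insert_idem, Set.insert_idem] at h2 h4
  rw [Set.insert_comm w v, Set.insert_idem, Set.insert_idem] at h3 h4
  have m1 := mvcOn_mono (G := G) (A := A) (Set.subset_insert u (insert w S))
  have m2 := mvcOn_mono (G := G) (A := B) (Set.subset_insert v (insert w T))
  rw [Set.insert_union] at h2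
  rw [Set.union_insert] at h3
  rw [Set.insert_union, Set.union_insert] at h4
  simp only [paramsOf, glue, EdgeParams.mk.injEq]
  refine ⟨?_, ?_, ?_, ?_⟩ <;> omega

end Glue

/-! ### The possible profiles of a segment -/

lemma EdgeParams.ext_iff {X Y : EdgeParams} :
    X = Y ↔ X.free = Y.free ∧ X.fst = Y.fst ∧ X.snd = Y.snd ∧ X.both = Y.both := by
  cases X; cases Y; simp

/-- All four values increased by `k`. -/
def EdgeParams.shift (k : ℤ) (X : EdgeParams) : EdgeParams :=
  ⟨X.free + k, X.fst + k, X.snd + k, X.both + k⟩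

/-- The relations between the four mvc parameters with respect to an edge: one of its ends is in
any given cover, and the prescription of one more vertex costs at most `1`. -/
def EdgeParams.Valid (X : EdgeParams) : Prop :=
  X.free = min X.fst X.snd ∧ X.fst ≤ X.free + 1 ∧ X.snd ≤ X.free + 1 ∧
    X.fst ≤ X.both ∧ X.both ≤ X.fst + 1 ∧ X.snd ≤ X.both ∧ X.both ≤ X.snd + 1

lemma EdgeParams.Valid.cases {X : EdgeParams} (h : X.Valid) :
    (X.fst = X.free ∧ X.snd = X.free ∧ X.both = X.free) ∨
      (X.fst = X.free ∧ X.snd = X.free ∧ X.both = X.free + 1) ∨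
      (X.fst = X.free ∧ X.snd = X.free + 1 ∧ X.both = X.free + 1) ∨
      (X.fst = X.free + 1 ∧ X.snd = X.free ∧ X.both = X.free + 1) := by
  unfold EdgeParams.Valid at h
  omega

/-- `Y` arises from `X` by the prescription of one more vertex. -/
def EdgeParams.Step (X Y : EdgeParams) : Prop :=
  (X.free ≤ Y.free ∧ Y.free ≤ X.free + 1) ∧ (X.fst ≤ Y.fst ∧ Y.fst ≤ X.fst + 1) ∧
    (X.snd ≤ Y.snd ∧ Y.snd ≤ X.snd + 1) ∧ (X.both ≤ Y.both ∧ Y.both ≤ X.both + 1)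

/-- The parameters with an end of the edge prescribed in addition. -/
def EdgeParams.forced (X : EdgeParams) : List EdgeParams :=
  [⟨X.fst, X.fst, X.both, X.both⟩, ⟨X.snd, X.both, X.snd, X.both⟩]

/-- What is used of the mvc parameters `X` of a segment and of the set `F` of its mvc parameters
with one more vertex prescribed, where that vertex ranges over the segment. -/
structure IsProfile (X : EdgeParams) (F : Set EdgeParams) : Prop where
  valid : X.Valid
  mem_valid : ∀ Y ∈ F, Y.Valid
  step : ∀ Y ∈ F, X.Step Y
  forced_mem : ∀ Y ∈ X.forced, Y ∈ F

/-- The values in `E` are the componentwise maxima over `F`. -/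
def IsMaxParams (F : Set EdgeParams) (E : EdgeParams) : Prop :=
  IsGreatest (EdgeParams.free '' F) E.free ∧ IsGreatest (EdgeParams.fst '' F) E.fst ∧
    IsGreatest (EdgeParams.snd '' F) E.snd ∧ IsGreatest (EdgeParams.both '' F) E.both

lemma IsMaxParams.unique {F : Set EdgeParams} {E E' : EdgeParams} (h : IsMaxParams F E)
    (h' : IsMaxParams F E') : E = E' :=
  EdgeParams.ext_iff.2 ⟨h.1.unique h'.1, h.2.1.unique h'.2.1, h.2.2.1.unique h'.2.2.1,
    h.2.2.2.unique h'.2.2.2⟩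

lemma IsMaxParams.shift {F : Set EdgeParams} {E : EdgeParams} (h : IsMaxParams F E) (k : ℤ) :
    IsMaxParams (EdgeParams.shift k '' F) (E.shift k) := by
  have key : ∀ (p : EdgeParams → ℤ) (_ : ∀ X, p (X.shift k) = p X + k),
      IsGreatest (p '' F) (p E) → IsGreatest (p '' (EdgeParams.shift k '' F)) (p (E.shift k)) := by
    rintro p hp ⟨⟨X, hX, hXE⟩, hub⟩
    refine ⟨⟨_, ⟨X, hX, rfl⟩, by rw [hp, hp, hXE]⟩, ?_⟩
    rintro _ ⟨_, ⟨Y, hY, rfl⟩, rfl⟩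
    rw [hp, hp]
    exact add_le_add_left (hub ⟨Y, hY, rfl⟩) k
  exact ⟨key _ (fun _ => rfl) h.1, key _ (fun _ => rfl) h.2.1, key _ (fun _ => rfl) h.2.2.1,
    key _ (fun _ => rfl) h.2.2.2⟩

/-- The largest value of `f` on a list (`0` for the empty list). -/
def listMax (f : EdgeParams → ℤ) : List EdgeParams → ℤ
  | [] => 0
  | [X] => f X
  | X :: Y :: l => max (f X) (listMax f (Y :: l))

lemma isGreatest_listMax (f : EdgeParams → ℤ) {l : List EdgeParams} (hl : l ≠ []) :
    IsGreatest (f '' {X | X ∈ l}) (listMax f l) := by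
  match l, hl with
  | [X], _ => simp [listMax]
  | X :: Y :: l, _ =>
    have ih := isGreatest_listMax f (l := Y :: l) (by simp)
    have hset : f '' {Z | Z ∈ X :: Y :: l} = insert (f X) (f '' {Z | Z ∈ Y :: l}) := by
      rw [← Set.image_insert_eq]
      congr 1
      ext Z
      exact List.mem_cons
    rw [hset]
    exact ih.insert _

/-- The componentwise maxima of a list of parameters. -/
def maxParams (l : List EdgeParams) : EdgeParams :=
  ⟨listMax EdgeParams.free l, listMax EdgeParams.fst l, listMax EdgeParams.snd l,
    listMax EdgeParams.both l⟩

lemma isMaxParams_maxParams {l : List EdgeParams} (hl : l ≠ []) :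
    IsMaxParams {X | X ∈ l} (maxParams l) :=
  ⟨isGreatest_listMax _ hl, isGreatest_listMax _ hl, isGreatest_listMax _ hl,
    isGreatest_listMax _ hl⟩

/-- The valid parameters with `mvc = 0`, up to which all valid parameters are shifts; each with
the valid parameters that are a step away from it, other than the two forced ones. -/
def normalTypes : List (EdgeParams × List EdgeParams) :=
  [(⟨0, 0, 0, 0⟩, [⟨0, 0, 0, 1⟩, ⟨0, 0, 1, 1⟩, ⟨0, 1, 0, 1⟩, ⟨1, 1, 1, 1⟩]),
   (⟨0, 0, 0, 1⟩, [⟨0, 0, 0, 1⟩, ⟨1, 1, 1, 1⟩, ⟨1, 1, 1, 2⟩]),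
   (⟨0, 0, 1, 1⟩, [⟨1, 1, 1, 2⟩, ⟨1, 1, 2, 2⟩]),
   (⟨0, 1, 0, 1⟩, [⟨1, 1, 1, 2⟩, ⟨1, 2, 1, 2⟩])]

/-- Up to a shift there are finitely many profiles. -/
lemma IsProfile.exists_normal {X : EdgeParams} {F : Set EdgeParams} (h : IsProfile X F) :
    ∃ N ∈ normalTypes, ∃ l ∈ N.2.sublists, ∃ k : ℤ, X = N.1.shift k ∧
      F = EdgeParams.shift k '' {Y | Y ∈ N.1.forced ++ l} := by
  classical
  obtain ⟨N, hN, hX, hY⟩ : ∃ N ∈ normalTypes, X = N.1.shift X.free ∧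
      ∀ Y : EdgeParams, Y.Valid → X.Step Y → ∃ Z ∈ N.1.forced ++ N.2, Y = Z.shift X.free := by
    have hv := h.valid.cases
    clear h
    obtain ⟨x0, x1, x2, x3⟩ := X
    dsimp only at hv
    obtain ⟨N, hN, hX⟩ : ∃ N ∈ normalTypes, (⟨x0, x1, x2, x3⟩ : EdgeParams) = N.1.shift x0 := by
      simp only [normalTypes, EdgeParams.shift, List.mem_cons, List.not_mem_nil, or_false,
        exists_eq_or_imp, exists_eq_left, EdgeParams.mk.injEq]
      omega
    refine ⟨N, hN, hX, ?_⟩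
    rintro ⟨y0, y1, y2, y3⟩ hy hs
    have hy := hy.cases
    dsimp only at hy
    have hy0 : y0 = x0 ∨ y0 = x0 + 1 := by have := hs.1; dsimp only at this; omega
    simp only [normalTypes, List.mem_cons, List.not_mem_nil, or_false] at hN
    simp only [EdgeParams.Step] at hs
    rcases hN with rfl | rfl | rfl | rfl <;>
    · simp only [EdgeParams.shift, EdgeParams.mk.injEq, zero_add] at hX
      obtain ⟨-, rfl, rfl, rfl⟩ := hX
      rcases hy0 with rfl | rfl <;> rcases hy with ⟨rfl, rfl, rfl⟩ | ⟨rfl, rfl, rfl⟩ |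
          ⟨rfl, rfl, rfl⟩ | ⟨rfl, rfl, rfl⟩ <;>
        first
        | (exfalso; omega)
        | (simp only [EdgeParams.forced, EdgeParams.shift, List.cons_append, List.nil_append,
            List.mem_cons, List.not_mem_nil, or_false, exists_eq_or_imp, exists_eq_left,
            EdgeParams.mk.injEq]
           omega)
  refine ⟨N, hN, N.2.filter fun Y => Y.shift X.free ∈ F,
    List.mem_sublists.2 List.filter_sublist, X.free, hX, ?_⟩
  have hforced : ∀ Z ∈ N.1.forced, Z.shift X.free ∈ X.forced := by
    intro Z hZ
    rw [hX]
    simp only [EdgeParams.forced, List.mem_cons, List.not_mem_nil, or_false] at hZ ⊢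
    have h0 : N.1.free = 0 := by
      have := congrArg EdgeParams.free hX
      simp only [EdgeParams.shift] at this
      omega
    rcases hZ with rfl | rfl
    · left; simp [EdgeParams.shift, h0]
    · right; simp [EdgeParams.shift, h0]
  ext Y
  simp only [Set.mem_image, Set.mem_ofPred_eq, List.mem_append, List.mem_filter,
    decide_eq_true_eq]
  constructor
  · intro hYF
    obtain ⟨Z, hZ, rfl⟩ := hY Y (h.mem_valid Y hYF) (h.step Y hYF)
    exact ⟨Z, (List.mem_append.1 hZ).imp_right fun hZ => ⟨hZ, hYF⟩, rfl⟩
  · rintro ⟨Z, hZ | hZ, rfl⟩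
    · exact h.forced_mem _ (hforced Z hZ)
    · exact hZ.2

/-! ### The formulas, checked for all profiles -/

/-- The explicit formulas and the exhaustiveness of their case distinction. -/
def Determined (M E Mu Eu Mv Ev : EdgeParams) : Prop :=
  CasesExhaustive M.free E.free Mu Eu Mv Ev ∧
  M.free = mvcFormula Mu Mv ∧
  E.free = evcFormula M.free Mu Eu Mv Ev ∧
  (⟨E.fst, E.snd, E.both⟩ : EndParams) = endsFormula E.free M Mu Eu Mv Ev

instance : DecidableEq EndParams := fun X Y =>
  decidable_of_iff (X.atFst = Y.atFst ∧ X.atSnd = Y.atSnd ∧ X.atBoth = Y.atBoth)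
    (by cases X; cases Y; simp)

instance (M E Mu Eu Mv Ev : EdgeParams) : Decidable (Determined M E Mu Eu Mv Ev) := by
  unfold Determined CasesExhaustive
  infer_instance

/-- All three values increased by `k`. -/
def EndParams.shift (k : ℤ) (X : EndParams) : EndParams :=
  ⟨X.atFst + k, X.atSnd + k, X.atBoth + k⟩

lemma endsTight_shift (ε : ℤ) (M Mu Eu Mv Ev : EdgeParams) (a b : ℤ) :
    endsTight (ε + (a + b)) (M.shift (a + b)) (Mu.shift a) (Eu.shift a) (Mv.shift b)
      (Ev.shift b) = (endsTight ε M Mu Eu Mv Ev).shift (a + b) := by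
  have e1 : ε + (a + b) = Mu.free + a + (Mv.free + b) - 1 ↔ ε = Mu.free + Mv.free - 1 := by omega
  simp only [endsTight, EdgeParams.shift, e1]
  split_ifs <;> simp only [EndParams.shift, EndParams.mk.injEq] <;> refine ⟨?_, ?_, ?_⟩ <;>
    first | trivial | omega

lemma endsMixed_shift (ε : ℤ) (M Mu Eu Mv Ev : EdgeParams) (a b : ℤ) :
    endsMixed (ε + (a + b)) (M.shift (a + b)) (Mu.shift a) (Eu.shift a) (Mv.shift b)
      (Ev.shift b) = (endsMixed ε M Mu Eu Mv Ev).shift (a + b) := by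
  have e1 : M.free + (a + b) = Mu.free + a + (Mv.free + b) - 1 ↔
    M.free = Mu.free + Mv.free - 1 := by omega
  have e2 : ε + (a + b) = Mu.free + a + (Mv.free + b) ↔ ε = Mu.free + Mv.free := by omega
  simp only [endsMixed, EdgeParams.shift, e1, e2]
  split_ifs <;> simp only [EndParams.shift, EndParams.mk.injEq] <;> refine ⟨?_, ?_, ?_⟩ <;>
    first | trivial | omega

lemma endsSlack_shift (M Mu Eu Mv Ev : EdgeParams) (a b : ℤ) :
    endsSlack (M.shift (a + b)) (Mu.shift a) (Eu.shift a) (Mv.shift b) (Ev.shift b) =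
      (endsSlack M Mu Eu Mv Ev).shift (a + b) := by
  have e1 : M.both + (a + b) ≤ Mu.free + a + (Mv.free + b) ↔ M.both ≤ Mu.free + Mv.free := by
    omega
  simp only [endsSlack, EdgeParams.shift, e1]
  split_ifs <;> simp only [EndParams.shift, EndParams.mk.injEq] <;> refine ⟨?_, ?_, ?_⟩ <;>
    first | trivial | omega

lemma endsFormula_shift (ε : ℤ) (M Mu Eu Mv Ev : EdgeParams) (a b : ℤ) :
    endsFormula (ε + (a + b)) (M.shift (a + b)) (Mu.shift a) (Eu.shift a) (Mv.shift b)
      (Ev.shift b) = (endsFormula ε M Mu Eu Mv Ev).shift (a + b) := by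
  have hswap : (endsMixed (ε + (a + b)) (M.shift (a + b)).swap (Mv.shift b) (Ev.shift b)
      (Mu.shift a) (Eu.shift a)).swap = (endsMixed ε M.swap Mv Ev Mu Eu).swap.shift (a + b) := by
    rw [add_comm a b]
    exact congrArg EndParams.swap (endsMixed_shift ε M.swap Mv Ev Mu Eu b a)
  have e1 : (Eu.shift a).free = (Mu.shift a).free ↔ Eu.free = Mu.free := add_left_inj a
  have e2 : (Ev.shift b).free = (Mv.shift b).free ↔ Ev.free = Mv.free := add_left_inj b
  simp only [endsFormula, e1, e2, hswap, endsTight_shift, endsMixed_shift, endsSlack_shift]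
  split_ifs <;> rfl

lemma Determined.shift {M E Mu Eu Mv Ev : EdgeParams} (h : Determined M E Mu Eu Mv Ev)
    (a b : ℤ) : Determined (M.shift (a + b)) (E.shift (a + b)) (Mu.shift a) (Eu.shift a)
      (Mv.shift b) (Ev.shift b) := by
  obtain ⟨h1, h2, h3, h4⟩ := h
  refine ⟨?_, ?_, ?_, ?_⟩
  · simp only [CasesExhaustive, EdgeParams.shift] at h1 ⊢
    omega
  · simp only [mvcFormula, EdgeParams.shift] at h2 ⊢
    omega
  · simp only [evcFormula, evcMixed, EdgeParams.shift, add_left_inj] at h3 ⊢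
    split_ifs at h3 ⊢ <;> omega
  · exact (congrArg (EndParams.shift (a + b)) h4).trans
      (endsFormula_shift E.free M Mu Eu Mv Ev a b).symm

lemma glue_shift (t s : EdgeParams) (a b : ℤ) :
    glue (t.shift a) (s.shift b) = (glue t s).shift (a + b) := by
  simp only [glue, EdgeParams.shift, EdgeParams.mk.injEq]
  refine ⟨?_, ?_, ?_, ?_⟩ <;> omega

/-- The formulas hold for all pairs of normalized profiles, as a finite computation shows. -/
lemma determined_of_normal : ∀ N ∈ normalTypes, ∀ l ∈ N.2.sublists, ∀ N' ∈ normalTypes,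
    ∀ l' ∈ N'.2.sublists,
      Determined (glue N.1 N'.1)
        (maxParams ((N.1.forced ++ l).map (glue · N'.1) ++ (N'.1.forced ++ l').map (glue N.1)))
        N.1 (maxParams (N.1.forced ++ l)) N'.1 (maxParams (N'.1.forced ++ l')) := by
  decide +kernel

/-- The formulas hold for any two segments with the listed properties; `E` is composed of the
maxima over the vertices of the first and of the second segment. -/
theorem determined_of_isProfile {Mu Mv E Eu Ev : EdgeParams} {F F' : Set EdgeParams}
    (hu : IsProfile Mu F) (hv : IsProfile Mv F') (hEu : IsMaxParams F Eu)
    (hEv : IsMaxParams F' Ev)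
    (hE : IsMaxParams ((glue · Mv) '' F ∪ glue Mu '' F') E) :
    Determined (glue Mu Mv) E Mu Eu Mv Ev := by
  obtain ⟨N, hN, l, hl, a, rfl, rfl⟩ := hu.exists_normal
  obtain ⟨N', hN', l', hl', b, rfl, rfl⟩ := hv.exists_normal
  have hne : N.1.forced ++ l ≠ [] := by simp [EdgeParams.forced]
  have hne' : N'.1.forced ++ l' ≠ [] := by simp [EdgeParams.forced]
  rw [hEu.unique ((isMaxParams_maxParams hne).shift a),
    hEv.unique ((isMaxParams_maxParams hne').shift b), glue_shift]
  have hset : (glue · (N'.1.shift b)) '' (EdgeParams.shift a '' {Y | Y ∈ N.1.forced ++ l}) ∪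
      glue (N.1.shift a) '' (EdgeParams.shift b '' {Y | Y ∈ N'.1.forced ++ l'}) =
      EdgeParams.shift (a + b) '' {Y | Y ∈ (N.1.forced ++ l).map (glue · N'.1) ++
        (N'.1.forced ++ l').map (glue N.1)} := by
    ext Y
    simp only [Set.mem_union, Set.mem_image, Set.mem_ofPred_eq, exists_exists_and_eq_and,
      glue_shift, List.mem_append (s := List.map _ _), List.mem_map, or_and_right, exists_or]
  rw [hset] at hE
  rw [hE.unique ((isMaxParams_maxParams (by simp [EdgeParams.forced])).shift (a + b))]
  exact (determined_of_normal N hN l hl N' hN' l' hl').shift a b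

/-! ### Constant-time programs -/

/-- Integer expressions in the registers `x 0, x 1, …`. -/
inductive Expr
  | var (i : ℕ)
  | const (c : ℤ)
  | add (a b : Expr)
  | sub (a b : Expr)
  | ifLE (a b c d : Expr)

namespace Expr

/-- `ifLE a b c d` has the value of `c` if `a ≤ b` and that of `d` otherwise. -/
def eval (x : ℕ → ℤ) : Expr → ℤ
  | var i => x i
  | const c => c
  | add a b => a.eval x + b.eval x
  | sub a b => a.eval x - b.eval x
  | ifLE a b c d => if a.eval x ≤ b.eval x then c.eval x else d.eval x

/-- All registers that occur are below `n`. -/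
def Below (n : ℕ) : Expr → Prop
  | var i => i < n
  | const _ => True
  | add a b => a.Below n ∧ b.Below n
  | sub a b => a.Below n ∧ b.Below n
  | ifLE a b c d => a.Below n ∧ b.Below n ∧ c.Below n ∧ d.Below n

instance decidableBelow (n : ℕ) : (e : Expr) → Decidable (e.Below n)
  | var i => inferInstanceAs (Decidable (i < n))
  | const _ => inferInstanceAs (Decidable True)
  | add a b => @instDecidableAnd _ _ (decidableBelow n a) (decidableBelow n b)
  | sub a b => @instDecidableAnd _ _ (decidableBelow n a) (decidableBelow n b)
  | ifLE a b c d => @instDecidableAnd _ _ (decidableBelow n a) (@instDecidableAnd _ _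
      (decidableBelow n b) (@instDecidableAnd _ _ (decidableBelow n c) (decidableBelow n d)))

/-- Code that computes the expression into register `r`, to be placed at position `o` of a
program.  It reads registers below `r` and otherwise uses only registers from `r` on.
The comparison of register `r` with itself serves as an unconditional jump. -/
def compile : Expr → ℕ → ℕ → List Instr
  | var i, r, _ => [.const r 0, .add r i r]
  | const c, r, _ => [.const r c]
  | add a b, r, o =>
    a.compile r o ++ b.compile (r + 1) (o + (a.compile r o).length) ++ [.add r r (r + 1)]
  | sub a b, r, o =>
    a.compile r o ++ b.compile (r + 1) (o + (a.compile r o).length) ++ [.sub r r (r + 1)]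
  | ifLE a b c d, r, o =>
    let A := a.compile r o
    let B := b.compile (r + 1) (o + A.length)
    let D := d.compile r (o + A.length + B.length + 1)
    let C := c.compile r (o + A.length + B.length + 1 + D.length + 1)
    A ++ B ++ [.jumpLE r (r + 1) (o + A.length + B.length + 1 + D.length + 1)] ++ D ++
      [.jumpLE r r (o + A.length + B.length + 1 + D.length + 1 + C.length)] ++ C

end Expr

/-- From `z`, the program reaches `z'` in at most `n` steps. -/
def Reaches (P : Program) (n : ℕ) (z z' : State) : Prop :=
  ∃ t ≤ n, P.step^[t] z = z'

lemma Reaches.trans {P : Program} {n m : ℕ} {x y z : State} (h : Reaches P n x y)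
    (h' : Reaches P m y z) : Reaches P (n + m) x z := by
  obtain ⟨s, hs, rfl⟩ := h
  obtain ⟨t, ht, rfl⟩ := h'
  exact ⟨t + s, by omega, Function.iterate_add_apply _ _ _ _⟩

lemma Reaches.mono {P : Program} {n m : ℕ} {x y : State} (h : Reaches P n x y) (hnm : n ≤ m) :
    Reaches P m x y := by
  obtain ⟨s, hs, h⟩ := h
  exact ⟨s, hs.trans hnm, h⟩

/-- The code `c` stands at position `o` of `P`. -/
def CodeAt (P : Program) (o : ℕ) (c : List Instr) : Prop :=
  ∃ p q, P = p ++ c ++ q ∧ p.length = o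

lemma CodeAt.left {P : Program} {o : ℕ} {c d : List Instr} (h : CodeAt P o (c ++ d)) :
    CodeAt P o c := by
  obtain ⟨p, q, rfl, rfl⟩ := h
  exact ⟨p, d ++ q, by simp, rfl⟩

lemma CodeAt.right {P : Program} {o : ℕ} {c d : List Instr} (h : CodeAt P o (c ++ d)) :
    CodeAt P (o + c.length) d := by
  obtain ⟨p, q, rfl, rfl⟩ := h
  exact ⟨p ++ c, q, by simp, by simp⟩

lemma CodeAt.reaches {P : Program} {i : Instr} {z : State} (h : CodeAt P z.pc [i]) :
    Reaches P 1 z (i.exec z) := by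
  obtain ⟨p, q, rfl, ho⟩ := h
  refine ⟨1, le_rfl, ?_⟩
  simp only [Function.iterate_one, Program.step]
  rw [← ho]
  simp

lemma Expr.Below.mono {n m : ℕ} (hnm : n ≤ m) : ∀ {e : Expr}, e.Below n → e.Below m
  | .var _, h => lt_of_lt_of_le (show _ < n from h) hnm
  | .const _, _ => trivial
  | .add _ _, h => ⟨h.1.mono hnm, h.2.mono hnm⟩
  | .sub _ _, h => ⟨h.1.mono hnm, h.2.mono hnm⟩
  | .ifLE _ _ _ _, h =>
    ⟨h.1.mono hnm, h.2.1.mono hnm, h.2.2.1.mono hnm, h.2.2.2.mono hnm⟩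

lemma Expr.eval_congr {n : ℕ} {x y : ℕ → ℤ} (hxy : ∀ i < n, y i = x i) :
    ∀ {e : Expr}, e.Below n → e.eval y = e.eval x
  | .var i, h => hxy i h
  | .const _, _ => rfl
  | .add _ _, h => by rw [eval, eval, eval_congr hxy h.1, eval_congr hxy h.2]
  | .sub _ _, h => by rw [eval, eval, eval_congr hxy h.1, eval_congr hxy h.2]
  | .ifLE _ _ _ _, h => by
    rw [eval, eval, eval_congr hxy h.1, eval_congr hxy h.2.1, eval_congr hxy h.2.2.1,
      eval_congr hxy h.2.2.2]

/-- Running `P` from position `o`, one arrives at position `o'` after at most `n` steps with the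
value of `e` in register `r` and with the registers below `r` unchanged. -/
def Evaluates (P : Program) (e : Expr) (r o n o' : ℕ) : Prop :=
  ∀ x : ℕ → ℤ, ∃ y : ℕ → ℤ, Reaches P n ⟨o, x⟩ ⟨o', y⟩ ∧ y r = e.eval x ∧ ∀ i < r, y i = x i

lemma Evaluates.pair {P : Program} {a b : Expr} {r o n o' m o'' : ℕ}
    (ha : Evaluates P a r o n o') (hb : Evaluates P b (r + 1) o' m o'') (hbr : b.Below r)
    (x : ℕ → ℤ) : ∃ z : ℕ → ℤ, Reaches P (n + m) ⟨o, x⟩ ⟨o'', z⟩ ∧ z r = a.eval x ∧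
      z (r + 1) = b.eval x ∧ ∀ i < r, z i = x i := by
  obtain ⟨y, h1, h2, h3⟩ := ha x
  obtain ⟨z, h4, h5, h6⟩ := hb y
  refine ⟨z, h1.trans h4, (h6 r (by omega)).trans h2, ?_, fun i hi => ?_⟩
  · rw [h5, Expr.eval_congr h3 hbr]
  · rw [h6 i (by omega), h3 i hi]

lemma Expr.evaluates_compile (P : Program) (e : Expr) : ∀ (r o : ℕ),
    CodeAt P o (e.compile r o) → e.Below r →
      Evaluates P e r o (e.compile r o).length (o + (e.compile r o).length) := by
  induction e with
  | var i =>
    intro r o h hb x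
    have hi : i < r := hb
    have h1 : CodeAt P o [.const r 0] := CodeAt.left (d := [.add r i r]) h
    have h2 : CodeAt P (o + 1) [.add r i r] := CodeAt.right (c := [.const r 0]) h
    have s1 := CodeAt.reaches (z := ⟨o, x⟩) h1
    have s2 := CodeAt.reaches (z := ⟨o + 1, Function.update x r 0⟩) h2
    refine ⟨_, s1.trans s2, ?_, fun j hj => ?_⟩
    · simp [Function.update_of_ne hi.ne, eval]
    · simp [Function.update_of_ne hj.ne]
  | const c =>
    intro r o h hb x
    refine ⟨_, CodeAt.reaches (z := ⟨o, x⟩) h, ?_, fun j hj => ?_⟩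
    · simp [eval]
    · simp [Function.update_of_ne hj.ne]
  | add a b iha ihb =>
    intro r o h hb x
    simp only [compile] at h ⊢
    have hA := iha r o h.left.left hb.1
    have hB := ihb (r + 1) _ h.left.right (hb.2.mono (Nat.le_succ r))
    obtain ⟨z, h1, h2, h3, h4⟩ := hA.pair hB hb.2 x
    have h5 := h.right
    simp only [List.length_append, List.length_cons, List.length_nil, zero_add, ← add_assoc]
      at h5 ⊢
    have s := CodeAt.reaches (z := ⟨_, z⟩) h5
    refine ⟨Function.update z r (z r + z (r + 1)), h1.trans s, ?_, fun j hj => ?_⟩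
    · simp [eval, h2, h3]
    · rw [Function.update_of_ne hj.ne, h4 j hj]
  | sub a b iha ihb =>
    intro r o h hb x
    simp only [compile] at h ⊢
    have hA := iha r o h.left.left hb.1
    have hB := ihb (r + 1) _ h.left.right (hb.2.mono (Nat.le_succ r))
    obtain ⟨z, h1, h2, h3, h4⟩ := hA.pair hB hb.2 x
    have h5 := h.right
    simp only [List.length_append, List.length_cons, List.length_nil, zero_add, ← add_assoc]
      at h5 ⊢
    have s := CodeAt.reaches (z := ⟨_, z⟩) h5
    refine ⟨Function.update z r (z r - z (r + 1)), h1.trans s, ?_, fun j hj => ?_⟩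
    · simp [eval, h2, h3]
    · rw [Function.update_of_ne hj.ne, h4 j hj]
  | ifLE a b c d iha ihb ihc ihd =>
    intro r o h hb x
    simp only [compile] at h ⊢
    set A := a.compile r o
    set B := b.compile (r + 1) (o + A.length)
    set D := d.compile r (o + A.length + B.length + 1)
    set C := c.compile r (o + A.length + B.length + 1 + D.length + 1)
    have hA := iha r o h.left.left.left.left.left hb.1
    have hB := ihb (r + 1) _ h.left.left.left.left.right (hb.2.1.mono (Nat.le_succ r))
    have hj := h.left.left.left.right
    have hD' := h.left.left.right
    have hj' := h.left.right
    have hC' := h.right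
    simp only [List.length_append, List.length_cons, List.length_nil, zero_add, ← add_assoc]
      at hj hD' hj' hC' ⊢
    have hD := ihd r _ hD' hb.2.2.2
    have hC := ihc r _ hC' hb.2.2.1
    obtain ⟨z, h1, h2, h3, h4⟩ := hA.pair hB hb.2.1 x
    have s := CodeAt.reaches (z := ⟨_, z⟩) hj
    simp only [Instr.exec, h2, h3] at s
    by_cases hle : a.eval x ≤ b.eval x
    · rw [if_pos hle] at s
      obtain ⟨y, h5, h6, h7⟩ := hC z
      refine ⟨y, ((h1.trans s).trans h5).mono ?_, ?_, fun i hi => (h7 i hi).trans (h4 i hi)⟩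
      · change A.length + B.length + 1 + C.length ≤ _
        omega
      · rw [h6, eval, if_pos hle, eval_congr h4 hb.2.2.1]
    · rw [if_neg hle] at s
      obtain ⟨y, h5, h6, h7⟩ := hD z
      have s' := CodeAt.reaches (z := ⟨_, y⟩) hj'
      simp only [Instr.exec, le_refl, if_true] at s'
      refine ⟨y, (((h1.trans s).trans h5).trans s').mono ?_, ?_,
        fun i hi => (h7 i hi).trans (h4 i hi)⟩
      · change A.length + B.length + 1 + D.length + 1 ≤ _
        omega
      · rw [h6, eval, if_neg hle, eval_congr h4 hb.2.2.2]

/-- The program that computes three expressions in the registers below `n` into the registers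
`n`, `n + 1`, `n + 2` and then copies the results into the registers `0`, `1`, `2`. -/
def outputProgram (n : ℕ) (a b c : Expr) : Program :=
  let A := a.compile n 0
  let B := b.compile (n + 1) A.length
  let C := c.compile (n + 2) (A.length + B.length)
  A ++ B ++ C ++ [.const (n + 3) 0] ++ [.add 0 n (n + 3)] ++ [.add 1 (n + 1) (n + 3)] ++
    [.add 2 (n + 2) (n + 3)]

lemma outputProgram_spec {n : ℕ} {a b c : Expr} (hn : 2 < n) (ha : a.Below n) (hb : b.Below n)
    (hc : c.Below n) (x : ℕ → ℤ) :
    let P := outputProgram n a b c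
    ∀ T, P.length ≤ T → let z := P.step^[T] ⟨0, x⟩
    P.length ≤ z.pc ∧ z.reg 0 = a.eval x ∧ z.reg 1 = b.eval x ∧ z.reg 2 = c.eval x := by
  intro P T hT
  have h : CodeAt P 0 P := ⟨[], [], by simp, rfl⟩
  obtain ⟨z, ⟨t, ht, htz⟩, hpc, h0, h1, h2⟩ : ∃ z, Reaches P P.length ⟨0, x⟩ z ∧
      P.length ≤ z.pc ∧ z.reg 0 = a.eval x ∧ z.reg 1 = b.eval x ∧ z.reg 2 = c.eval x := by
    have hP : P = outputProgram n a b c := rfl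
    conv at h => arg 3; rw [hP]
    simp only [outputProgram] at hP h
    set A := a.compile n 0
    set B := b.compile (n + 1) A.length
    set C := c.compile (n + 2) (A.length + B.length)
    have hlen : P.length = A.length + B.length + C.length + 4 := by
      rw [hP]; simp [add_assoc]
    have c1 := h.left.left.left.left.left.left
    have c2 := h.left.left.left.left.left.right
    have c3 := h.left.left.left.left.right
    have c4 := h.left.left.left.right
    have c5 := h.left.left.right
    have c6 := h.left.right
    have c7 := h.right
    simp only [List.length_append, List.length_cons, List.length_nil, zero_add]
      at c2 c3 c4 c5 c6 c7
    have e1 := a.evaluates_compile P n 0 c1 ha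
    have e2 := b.evaluates_compile P (n + 1) _ c2 (hb.mono (by omega))
    have e3 := c.evaluates_compile P (n + 2) _ c3 (hc.mono (by omega))
    rw [zero_add] at e1
    obtain ⟨y, s1, y1, y2, y3⟩ := e1.pair e2 hb x
    obtain ⟨z, s2, z1, z2⟩ := e3 y
    rw [Expr.eval_congr y3 hc] at z1
    have s3 := CodeAt.reaches (z := ⟨_, z⟩) c4
    have s4 := s3.trans (CodeAt.reaches (z := ⟨_, _⟩) c5)
    have s5 := s4.trans (CodeAt.reaches (z := ⟨_, _⟩) c6)
    have s6 := s5.trans (CodeAt.reaches (z := ⟨_, _⟩) c7)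
    refine ⟨_, ((s1.trans s2).trans s6).mono (by rw [hlen]), by rw [hlen]; exact le_rfl,
      ?_, ?_, ?_⟩
    all_goals
      simp [Instr.exec, show n ≠ 0 by omega, z1, z2 n (by omega), z2 (n + 1) (by omega), y1, y2]
  -- the halted machine keeps its state
  have hhalt : P.step z = z := by
    have : P[z.pc]? = none := List.getElem?_eq_none hpc
    simp only [Program.step, this]
  have hfin : P.step^[T] ⟨0, x⟩ = z := by
    obtain ⟨k, hk⟩ := Nat.exists_eq_add_of_le (ht.trans hT)
    rw [hk, Nat.add_comm, Function.iterate_add_apply, htz]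
    exact Function.iterate_fixed hhalt k
  simp only [hfin]
  exact ⟨hpc, h0, h1, h2⟩

/-! ### Programs for the formulas -/

namespace Expr

instance : Add Expr := ⟨.add⟩
instance : Sub Expr := ⟨.sub⟩
instance : One Expr := ⟨.const 1⟩
instance : Min Expr := ⟨fun a b => .ifLE a b a b⟩
instance : Max Expr := ⟨fun a b => .ifLE a b b a⟩

/-- `ifEq a b c d` has the value of `c` if `a = b` and that of `d` otherwise. -/
def ifEq (a b c d : Expr) : Expr := .ifLE a b (.ifLE b a c d) d

variable (x : ℕ → ℤ) (a b c d : Expr)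

lemma eval_add : (a + b).eval x = a.eval x + b.eval x := rfl

lemma eval_sub : (a - b).eval x = a.eval x - b.eval x := rfl

lemma eval_one : (1 : Expr).eval x = 1 := rfl

lemma eval_min : (min a b).eval x = min (a.eval x) (b.eval x) := (min_def _ _).symm

lemma eval_max : (max a b).eval x = max (a.eval x) (b.eval x) := (max_def _ _).symm

lemma eval_ifLE :
    (ifLE a b c d).eval x = if a.eval x ≤ b.eval x then c.eval x else d.eval x := rfl

lemma eval_ifEq :
    (ifEq a b c d).eval x = if a.eval x = b.eval x then c.eval x else d.eval x := by
  simp only [ifEq, eval_ifLE]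
  split_ifs <;> first | rfl | omega

end Expr

/-- Expressions for the four parameters with respect to an edge. -/
structure EdgeExprs where
  free : Expr
  fst : Expr
  snd : Expr
  both : Expr

namespace EdgeExprs

/-- The values of the four expressions. -/
def eval (x : ℕ → ℤ) (X : EdgeExprs) : EdgeParams :=
  ⟨X.free.eval x, X.fst.eval x, X.snd.eval x, X.both.eval x⟩

/-- The expressions with respect to the reversed edge. -/
def swap (X : EdgeExprs) : EdgeExprs := ⟨X.free, X.snd, X.fst, X.both⟩

/-- The contents of four successive registers. -/
def regs (i : ℕ) : EdgeExprs := ⟨.var i, .var (i + 1), .var (i + 2), .var (i + 3)⟩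

end EdgeExprs

/-- Expressions for the three parameters at the ends of an edge. -/
structure EndExprs where
  atFst : Expr
  atSnd : Expr
  atBoth : Expr

namespace EndExprs

/-- The values of the three expressions. -/
def eval (x : ℕ → ℤ) (X : EndExprs) : EndParams :=
  ⟨X.atFst.eval x, X.atSnd.eval x, X.atBoth.eval x⟩

/-- The expressions with the ends of the edge exchanged. -/
def swap (X : EndExprs) : EndExprs := ⟨X.atSnd, X.atFst, X.atBoth⟩

/-- `X` if `a = b`, and `Y` otherwise. -/
def ifEq (a b : Expr) (X Y : EndExprs) : EndExprs :=
  ⟨.ifEq a b X.atFst Y.atFst, .ifEq a b X.atSnd Y.atSnd, .ifEq a b X.atBoth Y.atBoth⟩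

lemma eval_ifEq (x : ℕ → ℤ) (a b : Expr) (X Y : EndExprs) :
    (ifEq a b X Y).eval x = if a.eval x = b.eval x then X.eval x else Y.eval x := by
  simp only [ifEq, eval, Expr.eval_ifEq]
  split_ifs <;> rfl

end EndExprs

/-- The formula for `mvc` as an expression.  The following definitions likewise repeat the formulas
for the other parameters. -/
def mvcExpr (Mu Mv : EdgeExprs) : Expr :=
  min (Mu.snd + Mv.both - 1) (min (Mu.both + Mv.snd - 1) (Mu.free + Mv.free))

def evcMixedExpr (μ : Expr) (Mu Eu Ev : EdgeExprs) : Expr :=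
  min (μ + 1) (min (Eu.free + Ev.both - 1) (Mu.both + Ev.snd - 1))

def evcExpr (μ : Expr) (Mu Eu Mv Ev : EdgeExprs) : Expr :=
  .ifEq Eu.free Mu.free
    (.ifEq Ev.free Mv.free (max (Eu.snd + Mv.free - 1) (Mu.free + Ev.snd - 1))
      (evcMixedExpr μ Mu Eu Ev))
    (.ifEq Ev.free Mv.free (evcMixedExpr μ Mv Ev Eu)
      (min (μ + 1) (max (Eu.both + Mv.snd - 1) (Mu.snd + Ev.both - 1))))

def endsTightExpr (ε : Expr) (M Mu Eu Mv Ev : EdgeExprs) : EndExprs :=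
  .ifEq ε (Mu.free + Mv.free - 1)
    ⟨Eu.both + Mv.free - 1, Ev.both + Mu.free - 1, min (M.both + 1) (Eu.both + Ev.both - 1)⟩
    ⟨ε, ε, min (Eu.fst + Mv.free) (min (Ev.fst + Mu.free) (M.both + 1))⟩

def endsMixedExpr (ε : Expr) (M Mu Eu Mv Ev : EdgeExprs) : EndExprs :=
  .ifEq M.free (Mu.free + Mv.free - 1)
    ⟨Mu.both + Ev.free - 1,
      min (M.snd + 1) (min (Eu.snd + Ev.both - 1)
        (max (Mu.snd + Ev.both - 1) (Eu.free + Mv.fst))),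
      min (M.both + 1) (min (Eu.both + Ev.both - 1) (Eu.fst + max (Ev.both - 1) Mv.fst))⟩
    (.ifEq ε (Mu.free + Mv.free)
      ⟨Eu.fst + Ev.snd - 1,
        min (M.snd + 1) (min (Eu.snd + Ev.both - 1)
          (max (Mu.snd + Ev.both - 1) (Eu.free + Mv.fst))),
        min (ε + 1) (max (Eu.fst + Mv.fst) (Eu.fst + Ev.both - 1))⟩
      ⟨ε, ε, min (M.both + 1) (Eu.free + Ev.fst)⟩)

def endsSlackExpr (M Mu Eu Mv Ev : EdgeExprs) : EndExprs :=
  ⟨min (M.fst + 1) (Eu.fst + Ev.snd - 1),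
    min (M.snd + 1) (Ev.fst + Eu.snd - 1),
    .ifLE M.both (Mu.free + Mv.free) (M.both + 1)
      (min (M.both + 1)
        (max (min (Eu.both + Mv.both - 1) (Eu.fst + Mv.fst))
          (min (Mu.both + Ev.both - 1) (Mu.fst + Ev.fst))))⟩

def endsExpr (ε : Expr) (M Mu Eu Mv Ev : EdgeExprs) : EndExprs :=
  .ifEq Eu.free Mu.free
    (.ifEq Ev.free Mv.free (endsTightExpr ε M Mu Eu Mv Ev) (endsMixedExpr ε M Mu Eu Mv Ev))
    (.ifEq Ev.free Mv.free (endsMixedExpr ε M.swap Mv Ev Mu Eu).swap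
      (endsSlackExpr M Mu Eu Mv Ev))

section Eval

variable (x : ℕ → ℤ) (μ ε : Expr) (M Mu Eu Mv Ev : EdgeExprs)

lemma eval_mvcExpr : (mvcExpr Mu Mv).eval x = mvcFormula (Mu.eval x) (Mv.eval x) := by
  simp only [mvcExpr, mvcFormula, EdgeExprs.eval, Expr.eval_add, Expr.eval_sub, Expr.eval_one,
    Expr.eval_min]

lemma eval_evcExpr : (evcExpr μ Mu Eu Mv Ev).eval x =
    evcFormula (μ.eval x) (Mu.eval x) (Eu.eval x) (Mv.eval x) (Ev.eval x) := by
  simp only [evcExpr, evcFormula, evcMixedExpr, evcMixed, EdgeExprs.eval, Expr.eval_add,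
    Expr.eval_sub, Expr.eval_one, Expr.eval_min, Expr.eval_max, Expr.eval_ifEq]
  rfl

lemma eval_endsTightExpr : (endsTightExpr ε M Mu Eu Mv Ev).eval x =
    endsTight (ε.eval x) (M.eval x) (Mu.eval x) (Eu.eval x) (Mv.eval x) (Ev.eval x) := by
  simp only [endsTightExpr, endsTight, EndExprs.eval_ifEq]
  simp only [EndExprs.eval, EdgeExprs.eval, Expr.eval_add, Expr.eval_sub, Expr.eval_one,
    Expr.eval_min]
  rfl

lemma eval_endsMixedExpr : (endsMixedExpr ε M Mu Eu Mv Ev).eval x =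
    endsMixed (ε.eval x) (M.eval x) (Mu.eval x) (Eu.eval x) (Mv.eval x) (Ev.eval x) := by
  simp only [endsMixedExpr, endsMixed, EndExprs.eval_ifEq]
  simp only [EndExprs.eval, EdgeExprs.eval, Expr.eval_add, Expr.eval_sub, Expr.eval_one,
    Expr.eval_min, Expr.eval_max]
  rfl

lemma eval_endsSlackExpr : (endsSlackExpr M Mu Eu Mv Ev).eval x =
    endsSlack (M.eval x) (Mu.eval x) (Eu.eval x) (Mv.eval x) (Ev.eval x) := by
  simp only [endsSlackExpr, endsSlack, EndExprs.eval, EdgeExprs.eval, Expr.eval_add,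
    Expr.eval_sub, Expr.eval_one, Expr.eval_min, Expr.eval_max, Expr.eval_ifLE]
  rfl

lemma eval_endsExpr : (endsExpr ε M Mu Eu Mv Ev).eval x =
    endsFormula (ε.eval x) (M.eval x) (Mu.eval x) (Eu.eval x) (Mv.eval x) (Ev.eval x) := by
  have hswap : (endsMixedExpr ε M.swap Mv Ev Mu Eu).swap.eval x =
      (endsMixed (ε.eval x) (M.eval x).swap (Mv.eval x) (Ev.eval x) (Mu.eval x)
        (Eu.eval x)).swap :=
    congrArg EndParams.swap (eval_endsMixedExpr x ε M.swap Mv Ev Mu Eu)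
  simp only [endsExpr, endsFormula, EndExprs.eval_ifEq, hswap, eval_endsTightExpr,
    eval_endsMixedExpr, eval_endsSlackExpr]
  rfl

end Eval

/-- The program for `evc`; the input is in the order `Mu`, `Eu`, `Mv`, `Ev`. -/
def evcProgram : Program :=
  outputProgram 16 (evcExpr (mvcExpr (.regs 0) (.regs 8)) (.regs 0) (.regs 4) (.regs 8)
    (.regs 12)) (.const 0) (.const 0)

/-- The expressions for `evc_u`, `evc_v` and `evc_uv` in terms of the input `evc`, `M`, `Mu`,
`Eu`, `Mv`, `Ev`. -/
def endsOutput : EndExprs :=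
  endsExpr (.var 0) (.regs 1) (.regs 5) (.regs 9) (.regs 13) (.regs 17)

/-- The program for `evc_u`, `evc_v` and `evc_uv`. -/
def endsProgram : Program :=
  outputProgram 21 endsOutput.atFst endsOutput.atSnd endsOutput.atBoth

lemma Determined.evcProgram_computes {M E Mu Eu Mv Ev : EdgeParams}
    (h : Determined M E Mu Eu Mv Ev) {T : ℕ} (hT : evcProgram.length ≤ T) :
    evcProgram.ComputesWithin T (Mu.toList ++ Eu.toList ++ Mv.toList ++ Ev.toList) [E.free] := by
  set x : ℕ → ℤ := fun i => (Mu.toList ++ Eu.toList ++ Mv.toList ++ Ev.toList).getD i 0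
  obtain ⟨h1, h2, -, -⟩ := outputProgram_spec (n := 16) (by norm_num) (by decide) (by decide)
    (by decide) x T hT
  refine ⟨h1, fun i hi => ?_⟩
  obtain rfl : i = 0 := by simpa using hi
  refine h2.trans ?_
  rw [eval_evcExpr, eval_mvcExpr]
  change evcFormula (mvcFormula Mu Mv) Mu Eu Mv Ev = E.free
  rw [← h.2.1, ← h.2.2.1]

lemma Determined.endsProgram_computes {M E Mu Eu Mv Ev : EdgeParams}
    (h : Determined M E Mu Eu Mv Ev) {T : ℕ} (hT : endsProgram.length ≤ T) :
    endsProgram.ComputesWithin T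
      (E.free :: M.toList ++ Mu.toList ++ Eu.toList ++ Mv.toList ++ Ev.toList)
      [E.fst, E.snd, E.both] := by
  set x : ℕ → ℤ := fun i =>
    (E.free :: M.toList ++ Mu.toList ++ Eu.toList ++ Mv.toList ++ Ev.toList).getD i 0
  obtain ⟨h1, h2⟩ := outputProgram_spec (n := 21) (a := endsOutput.atFst)
    (b := endsOutput.atSnd) (c := endsOutput.atBoth) (by norm_num) (by decide) (by decide)
    (by decide) x T hT
  have heval : endsOutput.eval x = ⟨E.fst, E.snd, E.both⟩ := by
    rw [endsOutput, eval_endsExpr]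
    exact h.2.2.2.symm
  simp only [EndExprs.eval, EndParams.mk.injEq] at heval
  rw [heval.1, heval.2.1, heval.2.2] at h2
  refine ⟨h1, fun i hi => ?_⟩
  match i, hi with
  | 0, _ => exact h2.1
  | 1, _ => exact h2.2.1
  | 2, _ => exact h2.2.2

/-! ### Profiles of graphs -/

section Profiles

variable {V : Type u}

/-- The mvc parameters that arise by the prescription of one more vertex. -/
def profileSet (G : SimpleGraph V) (a b : V) : Set EdgeParams :=
  Set.range fun x => paramsOf (mvc G) a b {x}

lemma paramsOf_mvc_empty (G : SimpleGraph V) (a b : V) :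
    paramsOf (mvc G) a b ∅ = mvcParams G a b := by
  simp only [paramsOf, mvcParams, insert_empty_eq]

lemma valid_paramsOf [Finite V] {G : SimpleGraph V} {a b : V} (hab : G.Adj a b) (S : Set V) :
    (paramsOf (mvc G) a b S).Valid := by
  have h1 := mvc_eq_min_of_adj S hab
  have h2 := mvc_insert_le (G := G) S a
  have h3 := mvc_insert_le (G := G) S b
  have h4 := mvc_insert_le (G := G) (insert b S) a
  have h5 := mvc_insert_le (G := G) (insert a S) b
  have h6 := mvc_mono (G := G) (Set.subset_insert b (insert a S))
  have h7 := mvc_mono (G := G) (Set.subset_insert a (insert b S))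
  rw [Set.insert_comm] at h5 h6
  simp only [EdgeParams.Valid, paramsOf]
  omega

lemma isProfile [Finite V] {G : SimpleGraph V} {a b : V} (hab : G.Adj a b) :
    IsProfile (mvcParams G a b) (profileSet G a b) where
  valid := paramsOf_mvc_empty G a b ▸ valid_paramsOf hab ∅
  mem_valid := by
    rintro _ ⟨x, rfl⟩
    exact valid_paramsOf hab {x}
  step := by
    rintro _ ⟨x, rfl⟩
    have key : ∀ S : Set V, (mvc G S : ℤ) ≤ mvc G (insert x S) ∧
        (mvc G (insert x S) : ℤ) ≤ mvc G S + 1 := fun S =>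
      ⟨by exact_mod_cast mvc_mono (Set.subset_insert x S), by exact_mod_cast mvc_insert_le S x⟩
    have h0 := key ∅
    have h1 := key {a}
    have h2 := key {b}
    have h3 := key {a, b}
    rw [insert_empty_eq] at h0
    rw [Set.pair_comm] at h1 h2
    rw [Set.insert_comm, Set.pair_comm x b] at h3
    exact ⟨h0, h1, h2, h3⟩
  forced_mem := by
    intro Y hY
    simp only [EdgeParams.forced, List.mem_cons, List.not_mem_nil, or_false] at hY
    rcases hY with rfl | rfl
    · exact ⟨a, by simp [paramsOf, mvcParams, Set.pair_comm b a]⟩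
    · exact ⟨b, by simp [paramsOf, mvcParams]⟩

lemma isMaxParams_evc [Finite V] (m : GuardModel) {G : SimpleGraph V} (a b : V)
    (hconn : ∀ C : Finset V, G.IsVertexCover (C : Set V) → (G.induce (C : Set V)).Connected)
    (hiso : ∀ x, ∃ y, G.Adj x y) : IsMaxParams (profileSet G a b) (evcParams m G a b) := by
  have : Nonempty V := ⟨a⟩
  have key : ∀ (p : EdgeParams → ℤ) (S : Set V),
      (∀ x, p (paramsOf (mvc G) a b {x}) = mvc G (insert x S)) →
        IsGreatest (p '' profileSet G a b) (evc m G S) := by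
    intro p S hp
    obtain ⟨⟨x, hx⟩, hub⟩ := isGreatest_evc m S hconn hiso
    refine ⟨⟨_, ⟨x, rfl⟩, by rw [hp]; exact_mod_cast hx⟩, ?_⟩
    rintro _ ⟨_, ⟨y, rfl⟩, rfl⟩
    rw [hp]
    exact_mod_cast hub ⟨y, rfl⟩
  refine ⟨key _ ∅ fun x => ?_, key _ {a} fun x => ?_, key _ {b} fun x => ?_,
    key _ {a, b} fun x => ?_⟩
  · simp [paramsOf]
  · simp [paramsOf, Set.pair_comm a x]
  · simp [paramsOf, Set.pair_comm b x]
  · rw [Set.insert_comm, Set.pair_comm x b]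
    rfl

variable {G : SimpleGraph V} {a b : V} {A : Set V}

/-- All vertex covers of a segment, as a graph of its own, are connected. -/
lemma Triangulated.connected_cover_coe (h : Triangulated G a b A)
    (C : Finset ((⊤ : G.Subgraph).induce A).verts)
    (hC : ((⊤ : G.Subgraph).induce A).coe.IsVertexCover (C : Set _)) :
    (((⊤ : G.Subgraph).induce A).coe.induce (C : Set _)).Connected := by
  let C' : Set V := Subtype.val '' (C : Set ((⊤ : G.Subgraph).induce A).verts)
  have hconn : (G.induce (C' ∩ A)).Connected := h.connected_cover fun x hx y hy hxy => by
    have hadj : ((⊤ : G.Subgraph).induce A).coe.Adj ⟨x, hx⟩ ⟨y, hy⟩ := ⟨hx, hy, hxy⟩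
    exact (hC hadj).imp (fun h => ⟨_, h, rfl⟩) fun h => ⟨_, h, rfl⟩
  have hmem : ∀ x : ↥(C' ∩ A), (⟨x, x.2.2⟩ : ((⊤ : G.Subgraph).induce A).verts) ∈ (C : Set _) := by
    rintro ⟨_, ⟨y, hy, rfl⟩, hA⟩
    exact hy
  let f : G.induce (C' ∩ A) →g ((⊤ : G.Subgraph).induce A).coe.induce (C : Set _) :=
    { toFun := fun x : ↥(C' ∩ A) => ⟨⟨x, x.2.2⟩, hmem x⟩
      map_rel' := fun {x y} hxy => ⟨x.2.2, y.2.2, hxy⟩ }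
  exact hconn.map f fun y => ⟨⟨y.1, ⟨y.1, y.2, rfl⟩, y.1.2⟩, rfl⟩

lemma Triangulated.exists_adj_coe (h : Triangulated G a b A)
    (x : ((⊤ : G.Subgraph).induce A).verts) :
    ∃ y, ((⊤ : G.Subgraph).induce A).coe.Adj x y := by
  obtain ⟨y, hy, hxy⟩ := h.exists_adj x.2
  exact ⟨⟨y, hy⟩, x.2, hy, hxy⟩

lemma paramsOf_mvcOn (ha : a ∈ A) (hb : b ∈ A) (S : Set V) :
    paramsOf (mvcOn G A) a b S = paramsOf (mvc ((⊤ : G.Subgraph).induce A).coe) ⟨a, ha⟩ ⟨b, hb⟩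
      (Subtype.val ⁻¹' S) := by
  have e := fun {x : V} (hx : x ∈ A) (S : Set V) =>
    preimage_val_insert (A := ((⊤ : G.Subgraph).induce A).verts) hx S
  simp only [paramsOf, mvcOn]
  rw [e ha, e ha, e hb]

/-- The parameters of the whole graph are determined by those of its two segments. -/
lemma SplitsAt.determined [Finite V] {u v w : V} {B : Set V} (h : SplitsAt G u v w A B)
    (m : GuardModel) :
    Determined (mvcParams G u v) (evcParams m G u v)
      (mvcParams ((⊤ : G.Subgraph).induce A).coe ⟨u, h.left.left_mem⟩ ⟨w, h.left.right_mem⟩)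
      (evcParams m ((⊤ : G.Subgraph).induce A).coe ⟨u, h.left.left_mem⟩ ⟨w, h.left.right_mem⟩)
      (mvcParams ((⊤ : G.Subgraph).induce B).coe ⟨v, h.right.left_mem⟩ ⟨w, h.right.right_mem⟩)
      (evcParams m ((⊤ : G.Subgraph).induce B).coe ⟨v, h.right.left_mem⟩
        ⟨w, h.right.right_mem⟩) := by
  have hE := isMaxParams_evc m u v
    (fun C hC => by
      have := h.triangulated.connected_cover (C := (C : Set V)) fun x _ y _ hxy => hC hxy
      rwa [Set.inter_univ] at this)
    (fun x => let ⟨y, _, hy⟩ := h.triangulated.exists_adj (Set.mem_univ x); ⟨y, hy⟩)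
  have hEu := isMaxParams_evc m (⟨u, h.left.left_mem⟩ : ((⊤ : G.Subgraph).induce A).verts)
    ⟨w, h.left.right_mem⟩ h.left.connected_cover_coe h.left.exists_adj_coe
  have hEv := isMaxParams_evc m (⟨v, h.right.left_mem⟩ : ((⊤ : G.Subgraph).induce B).verts)
    ⟨w, h.right.right_mem⟩ h.right.connected_cover_coe h.right.exists_adj_coe
  have hu := isProfile (G := ((⊤ : G.Subgraph).induce A).coe) (a := ⟨u, h.left.left_mem⟩)
    (b := ⟨w, h.left.right_mem⟩) ⟨h.left.left_mem, h.left.right_mem, h.left.adj⟩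
  have hv := isProfile (G := ((⊤ : G.Subgraph).induce B).coe) (a := ⟨v, h.right.left_mem⟩)
    (b := ⟨w, h.right.right_mem⟩) ⟨h.right.left_mem, h.right.right_mem, h.right.adj⟩
  have eA := paramsOf_mvcOn (G := G) h.left.left_mem h.left.right_mem ∅
  have eB := paramsOf_mvcOn (G := G) h.right.left_mem h.right.right_mem ∅
  rw [Set.preimage_empty, paramsOf_mvc_empty] at eA eB
  have hM : mvcParams G u v = glue (paramsOf (mvcOn G A) u w ∅) (paramsOf (mvcOn G B) v w ∅) := by
    have := h.paramsOf_mvc (Set.empty_subset A) (Set.empty_subset B)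
    rwa [Set.union_empty, paramsOf_mvc_empty] at this
  have hF : profileSet G u v =
      (glue · (paramsOf (mvcOn G B) v w ∅)) '' profileSet ((⊤ : G.Subgraph).induce A).coe
          ⟨u, h.left.left_mem⟩ ⟨w, h.left.right_mem⟩ ∪
        glue (paramsOf (mvcOn G A) u w ∅) '' profileSet ((⊤ : G.Subgraph).induce B).coe
          ⟨v, h.right.left_mem⟩ ⟨w, h.right.right_mem⟩ := by
    have hpre : ∀ {D : Set V} (x : ((⊤ : G.Subgraph).induce D).verts),
        Subtype.val ⁻¹' {(x : V)} = ({x} : Set _) := fun x => by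
      ext y; simp [Subtype.ext_iff]
    have hA : ∀ x : ((⊤ : G.Subgraph).induce A).verts, paramsOf (mvc G) u v {(x : V)} =
        glue (paramsOf (mvc ((⊤ : G.Subgraph).induce A).coe) ⟨u, h.left.left_mem⟩
          ⟨w, h.left.right_mem⟩ {x}) (paramsOf (mvcOn G B) v w ∅) := fun x => by
      have := h.paramsOf_mvc (Set.singleton_subset_iff.2 x.2) (Set.empty_subset B)
      rwa [Set.union_empty, paramsOf_mvcOn h.left.left_mem h.left.right_mem, hpre] at this
    have hB : ∀ x : ((⊤ : G.Subgraph).induce B).verts, paramsOf (mvc G) u v {(x : V)} =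
        glue (paramsOf (mvcOn G A) u w ∅) (paramsOf (mvc ((⊤ : G.Subgraph).induce B).coe)
          ⟨v, h.right.left_mem⟩ ⟨w, h.right.right_mem⟩ {x}) := fun x => by
      have := h.paramsOf_mvc (Set.empty_subset A) (Set.singleton_subset_iff.2 x.2)
      rwa [Set.empty_union, paramsOf_mvcOn h.right.left_mem h.right.right_mem, hpre] at this
    ext X
    constructor
    · rintro ⟨x, rfl⟩
      rcases h.mem_or_mem x with hx | hx
      · exact Or.inl ⟨_, ⟨⟨x, hx⟩, rfl⟩, (hA ⟨x, hx⟩).symm⟩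
      · exact Or.inr ⟨_, ⟨⟨x, hx⟩, rfl⟩, (hB ⟨x, hx⟩).symm⟩
    · rintro (⟨_, ⟨x, rfl⟩, rfl⟩ | ⟨_, ⟨x, rfl⟩, rfl⟩)
      · exact ⟨x, hA x⟩
      · exact ⟨x, hB x⟩
  rw [eA, eB] at hM hF
  rw [hM]
  rw [hF] at hE
  exact determined_of_isProfile hu hv hEu hEv hE

end Profiles

end EternalCover

theorem mainTheorem1 :
    ∃ (P Q : EternalCover.Program) (T : ℕ),
      ∀ (V : Type u) [Fintype V] (G : SimpleGraph V) [DecidableRel G.Adj]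
        (_hG : EternalCover.IsMaximalOuterplanar G) (φ : EternalCover.OuterplanarEmbedding G)
        (u v : V) (_huv : φ.IsOuterEdge ⊤ u v) (_hu : 2 < G.degree u) (_hv : 2 < G.degree v),
        ∃ (w : V) (Gu Gv : G.Subgraph) (hu : u ∈ Gu.verts) (huw : w ∈ Gu.verts)
          (hv : v ∈ Gv.verts) (hvw : w ∈ Gv.verts),
          (∀ x, (G.Adj u x ∧ G.Adj v x) ↔ x = w) ∧
          φ.IsSegment u v w Gu ∧ φ.IsSegment v u w Gv ∧
          ∀ m : EternalCover.GuardModel,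
            EternalCover.DeterminedWithin P Q T
              (EternalCover.mvcParams G u v)
              (EternalCover.evcParams m G u v)
              (EternalCover.mvcParams Gu.coe ⟨u, hu⟩ ⟨w, huw⟩)
              (EternalCover.evcParams m Gu.coe ⟨u, hu⟩ ⟨w, huw⟩)
              (EternalCover.mvcParams Gv.coe ⟨v, hv⟩ ⟨w, hvw⟩)
              (EternalCover.evcParams m Gv.coe ⟨v, hv⟩ ⟨w, hvw⟩) := by
  refine ⟨EternalCover.evcProgram, EternalCover.endsProgram,
    max EternalCover.evcProgram.length EternalCover.endsProgram.length, ?_⟩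
  intro V _ G _ hG φ u v huv hu _
  obtain ⟨x, hxu, hxv⟩ : ∃ x, x ≠ u ∧ x ≠ v := by
    obtain ⟨x, hx, hxv⟩ := Finset.exists_mem_ne
      (show 1 < (G.neighborFinset u).card by rw [G.card_neighborFinset_eq_degree]; omega) v
    exact ⟨x, ((G.mem_neighborFinset u x).1 hx).ne', hxv⟩
  obtain ⟨w, A, B, h⟩ := hG.exists_splitsAt huv hxu hxv
  refine ⟨w, (⊤ : G.Subgraph).induce A, (⊤ : G.Subgraph).induce B, h.left.left_mem,
    h.left.right_mem, h.right.left_mem, h.right.right_mem, h.common_neighbour_iff,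
    h.isSegment φ, h.symm.isSegment φ, fun m => ?_⟩
  have hdet := h.determined m
  exact ⟨hdet.1, hdet.2.1, hdet.2.2.1, hdet.2.2.2, hdet.evcProgram_computes (le_max_left _ _),
    hdet.endsProgram_computes (le_max_right _ _)⟩
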